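/- **Setting.** Let $\mathbb G_\infty=(V,E)$ be an infinite, locally finite, connected graph (multiple edges and self-loops allowed), and let $E_0\subseteq E_1\subseteq\dots\subseteq E$. Let $V_t$ be the set of $x\in V$ joined by an edge of $E_t$ to some $y\ne x$, and assume that each $\mathbb G_t=(V_t,E_t)$ is finite and connected. For $x,y\in V_t$ and $A,B\subseteq V_t$ let $\pi^{(t)}(x,y)$ be the number of edges of $E_t$ between $x$ and $y$ ($\pi^{(t)}(x,x)$ is the number of self-loops at $x$), $\pi^{(t)}(x)=\sum_{y\in V_t}\pi^{(t)}(x,y)$, $\pi^{(t)}(A)=\sum_{x\in A}\pi^{(t)}(x)$, $\pi^{(t)}(A,B)=\sum_{x\in A,y\in B}\pi^{(t)}(x,y)$, and $v(t)=\pi^{(t)}(V_t)$. For $r\ge0$ let $$\phi_t(r)=\inf\Big\{\frac{\pi^{(t)}(A,V_t\setminus A)}{\pi^{(t)}(A)}:\ \emptyset\ne A\subseteq V_t,\ \pi^{(t)}(A)\le \tfrac{v(t)}2\wedge r\Big\}\quad(\inf\emptyset=\infty),\qquad \Phi_t=\phi_t\big(\tfrac{v(t)}2\big).$$ Let $P(0,x_0;t,y)$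 be the transition probability from $x_0$ at time $0$ to $y$ at time $t$ of the time-inhomogeneous Markov chain (simple random walk) with one-step probabilities $P(t,x;t+1,y)=\pi^{(t)}(x,y)/\pi^{(t)}(x)$, $x,y\in V_t$. **Theorem 1.3.** Let $\gamma\in(0,1/2]$ and assume that the walk is uniformly $\gamma$-lazy: $P(t,x;t+1,x)\ge\gamma$ for all $t\ge0$ and $x\in V_t$. (1) For every $\alpha\in(0,1)$, with $c_+=\frac{2\alpha(1-\alpha)\gamma^2}{(1-\gamma)^2}$, and all $x_0\in V_0$, $t\ge2$ and $y\in V_t$, $$P(0,x_0;t,y)\le\min_{1\le s\le t-1}\Big\{\frac{2\pi^{(t)}(y)}{v(s)}+\pi^{(t)}(y)^{1-\alpha}L^{(s)}_t\Big\},$$ where $L^{(s)}_s=\pi^{(0)}(x_0)^{\alpha-1}$ and, for $s\le u\le t-1$, $L^{(s)}_{u+1}$ is the largest $\ell\in(0,L^{(s)}_u]$ such that $$\int_{\ell/2}^{L^{(s)}_u/2}\frac{dz}{c_+\,z\,\phi_u^2\big(z^{1/(\alpha-1)}\big)}\ge1$$ (the integrand is $0$ where $\phi_u=\infty$). (2)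 For every $\Delta$ there is a finite constant $C=C(\gamma,\Delta)$, depending only on $\gamma$ and $\Delta$, such that, if $\pi^{(t)}(y)\le\Delta$ for all $t\ge0$ and $y\in V_t$, then with $c_\star=\frac{\gamma^2}{2(1-\gamma)^2}$, for all $x_0\in V_0$, $t\ge2$ and $y\in V_t$, $$P(0,x_0;t,y)\le C\Big(\frac1{v(\lfloor t/2\rfloor)}+e^{-c_\star\sum_{u=\lfloor t/2\rfloor}^{t-1}\Phi_u^2}\Big).$$ -/

import Mathlib

open scoped ENNReal

noncomputable section

/-- A multigraph with vertex type `V` and edge type `E`; multiple edges and self-loops are allowed.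
Every edge `e` has an unordered pair of end points (a self-loop at `x` has end points `s(x, x)`). -/
structure Multigraph (V E : Type*) where
  ends : E → Sym2 V

namespace Multigraph

variable {V E : Type*}

/-- The underlying simple graph of the subgraph with edge set `F`. -/
def simple (M : Multigraph V E) (F : Set E) : SimpleGraph V where
  Adj x y := x ≠ y ∧ ∃ e ∈ F, M.ends e = s(x, y)
  symm := ⟨fun x y h => ⟨h.1.symm, by
    obtain ⟨-, e, he, h2⟩ := h
    exact ⟨e, he, by rw [h2, Sym2.eq_swap]⟩⟩⟩
  loopless := ⟨fun _ h => h.1 rfl⟩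

/-- The set of vertices that are joined by an edge of `F` to some other vertex. -/
def nonisolated (M : Multigraph V E) (F : Set E) : Set V :=
  {x | ∃ y, y ≠ x ∧ ∃ e ∈ F, M.ends e = s(x, y)}

end Multigraph

/-- An infinite, locally finite, connected multigraph `(V, E)` together with an increasing sequence
of edge sets `edges t`, `t ∈ ℕ`, such that each graph `G_t = (V_t, edges t)`, where `V_t` is the
set of non-isolated vertices at time `t`, is finite and connected. -/
structure GrowingGraph (V E : Type*) extends Multigraph V E where
  infinite : Infinite V
  locallyFinite : ∀ x, {e | x ∈ ends e}.Finite
  connected : (toMultigraph.simple Set.univ).Connected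
  edges : ℕ → Set E
  edges_mono : Monotone edges
  finite_verts : ∀ t, (toMultigraph.nonisolated (edges t)).Finite
  connected_at : ∀ t, ((toMultigraph.simple (edges t)).induce
    (toMultigraph.nonisolated (edges t))).Connected

namespace GrowingGraph

variable {V E : Type*}

/-- The finite vertex set `V_t`. -/
def verts (G : GrowingGraph V E) (t : ℕ) : Finset V := (G.finite_verts t).toFinset

/-- `π^{(t)}(x, y)`: the number of edges of `G_t` between `x` and `y`; for `x = y` it is the number
of self-loops at `x`. (The set is finite, by local finiteness.) -/
def mult (G : GrowingGraph V E) (t : ℕ) (x y : V) : ℕ :=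
  {e | e ∈ G.edges t ∧ G.ends e = s(x, y)}.ncard

/-- `π^{(t)}(x) = ∑_{y ∈ V_t} π^{(t)}(x, y)`. -/
def deg (G : GrowingGraph V E) (t : ℕ) (x : V) : ℝ := ∑ y ∈ G.verts t, (G.mult t x y : ℝ)

/-- `π^{(t)}(A, B) = ∑_{x ∈ A, y ∈ B} π^{(t)}(x, y)`. -/
def flow (G : GrowingGraph V E) (t : ℕ) (A B : Finset V) : ℝ :=
  ∑ x ∈ A, ∑ y ∈ B, (G.mult t x y : ℝ)

/-- `π^{(t)}(A) = ∑_{x ∈ A} π^{(t)}(x)`. -/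
def meas (G : GrowingGraph V E) (t : ℕ) (A : Finset V) : ℝ := ∑ x ∈ A, G.deg t x

/-- The volume `v(t) = π^{(t)}(V_t)`. -/
def vol (G : GrowingGraph V E) (t : ℕ) : ℝ := G.meas t (G.verts t)

open scoped Classical in
/-- The isoperimetric function `φ_t(r)`: the infimum of `π^{(t)}(A, A^c) / π^{(t)}(A)` over the
nonempty `A ⊆ V_t` with `π^{(t)}(A) ≤ min (v(t)/2) r`, where `A^c = V_t \ A`. It takes values in
`[0, ∞]`, and the infimum over the empty family is `∞`. -/
def iso (G : GrowingGraph V E) (t : ℕ) (r : ℝ) : ℝ≥0∞ :=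
  ⨅ (A : Finset V) (_ : A ⊆ G.verts t) (_ : A.Nonempty) (_ : G.meas t A ≤ min (G.vol t / 2) r),
    ENNReal.ofReal (G.flow t A (G.verts t \ A) / G.meas t A)

/-- The Cheeger constant `Φ_t = φ_t(v(t)/2)`, as a real number. It is always finite: `V_t` has at
least two elements, so the infimum is over a nonempty family (one of `A`, `A^c` qualifies). -/
def cheeger (G : GrowingGraph V E) (t : ℕ) : ℝ := (G.iso t (G.vol t / 2)).toReal

/-- One step of simple random walk: `P(t, x; t+1, y) = π^{(t)}(x, y) / π^{(t)}(x)`. -/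
def step (G : GrowingGraph V E) (t : ℕ) (x y : V) : ℝ := (G.mult t x y : ℝ) / G.deg t x

open scoped Classical in
/-- The transition probability `P(0, x₀; t, y)` of simple random walk on `G_0, G_1, …`, that is,
the probability that the time-inhomogeneous Markov chain with one-step probabilities `step` which
starts at `x₀` at time `0` is at `y` at time `t`. -/
def trans (G : GrowingGraph V E) (x₀ : V) : ℕ → V → ℝ
  | 0, y => if y = x₀ then 1 else 0
  | t + 1, y => ∑ z ∈ G.verts t, G.trans x₀ t z * G.step t z y

/-- The walk is uniformly `γ`-lazy: `P(t, x; t+1, x) ≥ γ` for all `t` and all `x ∈ V_t`. -/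
def UniformlyLazy (G : GrowingGraph V E) (γ : ℝ) : Prop :=
  ∀ t, ∀ x ∈ G.verts t, γ ≤ G.step t x x

/-- The integral `∫_{ℓ/2}^{L/2} dz / (c z φ_u(z^{1/(α-1)})²)` with values in `[0, ∞]`, for `c > 0`
and `0 < ℓ ≤ L`; the integrand is `0` where `φ_u = ∞`. -/
def isoIntegral (G : GrowingGraph V E) (c α : ℝ) (u : ℕ) (ℓ L : ℝ) : ℝ≥0∞ :=
  ∫⁻ z in Set.Ioc (ℓ / 2) (L / 2),
    (ENNReal.ofReal c * ENNReal.ofReal z * G.iso u (z ^ (1 / (α - 1))) ^ 2)⁻¹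

/-- The largest `ℓ ∈ (0, L]` for which the integral is at least `1`. -/
def nextL (G : GrowingGraph V E) (c α : ℝ) (u : ℕ) (L : ℝ) : ℝ :=
  sSup {ℓ : ℝ | 0 < ℓ ∧ ℓ ≤ L ∧ 1 ≤ G.isoIntegral c α u ℓ L}

/-- The sequence `u ↦ L^{(s)}_u`: it starts from `L^{(s)}_s = π^{(0)}(x₀)^{α-1}`, and `nextL` gives
`L^{(s)}_{u+1}` from `L^{(s)}_u` for `u ≥ s`. (The values at `u < s`, which play no role, are set
equal to the starting value.) -/
def iterL (G : GrowingGraph V E) (c α : ℝ) (x₀ : V) (s : ℕ) : ℕ → ℝ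
  | 0 => G.deg 0 x₀ ^ (α - 1)
  | u + 1 => if s ≤ u then G.nextL c α u (G.iterL c α x₀ s u) else G.deg 0 x₀ ^ (α - 1)

end GrowingGraph

end

/-! Fix `s`, and let h_u be the positive part of P(0,x₀;u,·)/π^(u) − 2/v(s). Degrees only grow, so
the constant 2/v(s) is a supersolution: h_{u+1} is at most the step-u average of h_u times
π^(u)/π^(u+1) ≤ 1 (`excess_succ_le`). Hence N_u = Σ π^(u) h_u^p does not increase in u. Since Σ
π^(u) h_u ≤ 1 and the walk has mass at most 1, {h_u > 0} has at most half the volume and {h_u > τ}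
has measure at most 1/τ. Every nonempty subset of {h_u > τ} therefore has conductance at least
φ_u(1/τ).

The analytic core is `lazy_contraction`: if w is supported on a set all of whose nonempty subsets
have conductance at least φ, one lazy reversible step multiplies the squared L² norm by at most 1 −
2γ²φ²/(1−γ)². For the second bound it is applied to h_u itself, with p = 2 and φ = Φ_u.

For the first bound take p = max(2, 1/α) and κ = (p−1)/(1−α), and let B be the Bregman distance of
s^p from τ, truncated to 0 below τ. Both s^p − B and √B are convex. By Jensen the first part of Σ π
h^p does not grow. Since B(Ph) ≤ (P√B(h))², the second part contracts by `lazy_contraction`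
(`rpow_contraction`). The non-contracting part is controlled by `truncation_loss_le`. Choosing τ =
(l/2)^{1/(1−α)} for a suitable l ≤ L_u gives N_{u+1} ≤ (l exp(−c₊φ²))^κ, and `le_nextL` bounds this
by L_{u+1}^κ. Interpolating between N_t ≤ L_t^κ and unit mass (`deg_mul_excess_le_rpow`) gives the
pointwise estimate. -/

section Coarea

/-! ### Coarea inequality for weighted graphs. -/

variable {V : Type*}

open scoped Classical in
theorem coarea_indicator (S B : Finset V) (hB : B ⊆ S) (n : V → V → ℝ)
    (hsymm : ∀ x y, n x y = n y x) :
    ∑ x ∈ S, ∑ y ∈ S, n x y * |(if x ∈ B then (1 : ℝ) else 0) - (if y ∈ B then 1 else 0)| =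
      2 * ∑ x ∈ B, ∑ y ∈ S \ B, n x y := by
  have h1 : ∀ x y, n x y * |(if x ∈ B then (1 : ℝ) else 0) - (if y ∈ B then 1 else 0)| =
      (if x ∈ B then (if y ∉ B then n x y else 0) else 0) +
      (if y ∈ B then (if x ∉ B then n x y else 0) else 0) := by
    intro x y
    by_cases hx : x ∈ B <;> by_cases hy : y ∈ B <;> simp [hx, hy]
  have h2 : ∑ x ∈ S, ∑ y ∈ S, (if x ∈ B then (if y ∉ B then n x y else 0) else 0) =
      ∑ x ∈ B, ∑ y ∈ S \ B, n x y := by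
    rw [← Finset.sum_subset hB]
    · refine Finset.sum_congr rfl fun x hx => ?_
      simp only [hx, if_true]
      rw [← Finset.sum_filter, Finset.sdiff_eq_filter]
    · intro x _ hx
      simp [hx]
  simp only [h1, Finset.sum_add_distrib]
  rw [h2, Finset.sum_comm (s := S) (t := S)]
  have h3 : ∑ y ∈ S, ∑ x ∈ S, (if y ∈ B then (if x ∉ B then n x y else 0) else 0) =
      ∑ x ∈ B, ∑ y ∈ S \ B, n x y := by
    rw [← h2]
    refine Finset.sum_congr rfl fun x _ => Finset.sum_congr rfl fun y _ => ?_
    rw [hsymm]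
  rw [h3]; ring

open scoped Classical in
/-- The coarea inequality for a nonnegative function supported on a set all of whose nonempty
subsets have conductance at least `φ`. -/
theorem coarea_inequality (S : Finset V) (n : V → V → ℝ) (hsymm : ∀ x y, n x y = n y x) (φ : ℝ)
    (k : ℕ) (A : Finset V) (hA : A ⊆ S) (hk : A.card = k)
    (hφ : ∀ B ⊆ A, B.Nonempty →
      φ * ∑ x ∈ B, ∑ y ∈ S, n x y ≤ ∑ x ∈ B, ∑ y ∈ S \ B, n x y)
    (ψ : V → ℝ) (hpos : ∀ x ∈ A, 0 ≤ ψ x) (hzero : ∀ x, x ∉ A → ψ x = 0) :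
    2 * (φ * ∑ x ∈ S, (∑ y ∈ S, n x y) * ψ x) ≤ ∑ x ∈ S, ∑ y ∈ S, n x y * |ψ x - ψ y| := by
  induction k generalizing A ψ with
  | zero =>
    rw [Finset.card_eq_zero] at hk
    subst hk
    simp [hzero]
  | succ k ih =>
    have hne : A.Nonempty := by rw [← Finset.card_pos]; omega
    -- Peel off the lowest layer: subtracting `ψ a` times the indicator of `A` removes `a` from the
    -- support, and every difference |ψ x − ψ y| splits additively between the two layers.
    obtain ⟨a, ha, hmin⟩ := A.exists_min_image ψ hne
    have hcard : (A.erase a).card = k := by rw [Finset.card_erase_of_mem ha]; omega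
    set χ : V → ℝ := fun x => if x ∈ A then 1 else 0 with hχ
    have key := ih (A.erase a) ((Finset.erase_subset _ _).trans hA) hcard
      (fun B hB => hφ B (hB.trans (Finset.erase_subset _ _)))
      (fun x => ψ x - ψ a * χ x)
      (fun x hx => by
        have hx' := Finset.mem_of_mem_erase hx
        simp only [hχ, hx', if_true]; linarith [hmin x hx'])
      (fun x hx => by
        by_cases hxA : x ∈ A
        · have : x = a := by
            by_contra hne
            exact hx (Finset.mem_erase.2 ⟨hne, hxA⟩)
          subst this
          simp [hχ, ha]
        · simp [hχ, hxA, hzero x hxA])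
    have hdecomp : ∀ x y, |ψ x - ψ y| =
        |(ψ x - ψ a * χ x) - (ψ y - ψ a * χ y)| + ψ a * |χ x - χ y| := by
      intro x y
      have ha0 := hpos a ha
      by_cases hx : x ∈ A <;> by_cases hy : y ∈ A
      · simp [hχ, hx, hy]
      · have := hmin x hx
        simp only [hχ, hx, hy, if_true, if_false, hzero y hy]
        rw [abs_of_nonneg (by linarith), abs_of_nonneg (by linarith), abs_of_nonneg (by linarith)]
        ring
      · have := hmin y hy
        simp only [hχ, hx, hy, if_true, if_false, hzero x hx]
        rw [abs_of_nonpos (by linarith), abs_of_nonpos (by linarith), abs_of_nonpos (by linarith)]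
        ring
      · simp [hχ, hx, hy, hzero]
    have hind := coarea_indicator S A hA n hsymm
    have hflow := hφ A subset_rfl hne
    have hmeas : ∑ x ∈ S, (∑ y ∈ S, n x y) * χ x = ∑ x ∈ A, ∑ y ∈ S, n x y := by
      rw [← Finset.sum_subset hA]
      · exact Finset.sum_congr rfl fun x hx => by simp [hχ, hx]
      · intro x _ hx; simp [hχ, hx]
    have e1 : ∑ x ∈ S, ∑ y ∈ S, n x y * |ψ x - ψ y| =
        ∑ x ∈ S, ∑ y ∈ S, n x y * |(ψ x - ψ a * χ x) - (ψ y - ψ a * χ y)| +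
        ψ a * ∑ x ∈ S, ∑ y ∈ S, n x y * |χ x - χ y| := by
      simp only [Finset.mul_sum, ← Finset.sum_add_distrib]
      refine Finset.sum_congr rfl fun x _ => Finset.sum_congr rfl fun y _ => ?_
      rw [hdecomp x y]; ring
    have e2 : ∑ x ∈ S, (∑ y ∈ S, n x y) * ψ x =
        ∑ x ∈ S, (∑ y ∈ S, n x y) * (ψ x - ψ a * χ x) +
          ψ a * ∑ x ∈ S, (∑ y ∈ S, n x y) * χ x := by
      simp only [Finset.mul_sum (s := S) (a := ψ a), ← Finset.sum_add_distrib]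
      refine Finset.sum_congr rfl fun x _ => ?_
      ring
    rw [e1, e2, hmeas]
    simp only [hχ] at hind ⊢
    rw [hind]
    have := mul_le_mul_of_nonneg_left hflow (hpos a ha)
    simp only [hχ] at key
    linarith

end Coarea

/-! ### L² contraction with Dirichlet boundary conditions. -/

section Dirichlet

variable {V : Type*}

theorem weighted_cauchy_schwarz (S : Finset V) (n a b r : V → V → ℝ) (hn : ∀ x y, 0 ≤ n x y)
    (ha : ∀ x y, 0 ≤ a x y) (hb : ∀ x y, 0 ≤ b x y) (hr : ∀ x y, r x y ^ 2 = a x y * b x y) :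
    (∑ x ∈ S, ∑ y ∈ S, n x y * r x y) ^ 2 ≤
      (∑ x ∈ S, ∑ y ∈ S, n x y * a x y) * ∑ x ∈ S, ∑ y ∈ S, n x y * b x y := by
  simp only [← Finset.sum_product']
  refine Finset.sum_sq_le_sum_mul_sum_of_sq_le_mul _ (fun i _ => mul_nonneg (hn _ _) (ha _ _))
    (fun i _ => mul_nonneg (hn _ _) (hb _ _)) fun i _ => ?_
  exact le_of_eq (by rw [mul_pow, hr]; ring)

theorem sum_sum_add_sq (S : Finset V) (n : V → V → ℝ) (hsymm : ∀ x y, n x y = n y x) (g : V → ℝ) :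
    ∑ x ∈ S, ∑ y ∈ S, n x y * (g x ^ 2 + g y ^ 2) =
      2 * ∑ x ∈ S, (∑ y ∈ S, n x y) * g x ^ 2 := by
  simp only [mul_add, Finset.sum_add_distrib]
  rw [Finset.sum_comm (s := S) (t := S) (f := fun x y => n x y * g y ^ 2)]
  have : ∑ y ∈ S, ∑ x ∈ S, n x y * g y ^ 2 = ∑ x ∈ S, ∑ y ∈ S, n x y * g x ^ 2 :=
    Finset.sum_congr rfl fun x _ => Finset.sum_congr rfl fun y _ => by rw [hsymm]
  rw [this]
  simp only [Finset.sum_mul]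
  ring

theorem sum_sum_sub_sq (S : Finset V) (n : V → V → ℝ) (hsymm : ∀ x y, n x y = n y x) (g : V → ℝ) :
    ∑ x ∈ S, ∑ y ∈ S, n x y * (g x - g y) ^ 2 =
      2 * (∑ x ∈ S, (∑ y ∈ S, n x y) * g x ^ 2 - ∑ x ∈ S, ∑ y ∈ S, n x y * (g x * g y)) := by
  rw [mul_sub, ← sum_sum_add_sq S n hsymm, Finset.mul_sum, ← Finset.sum_sub_distrib]
  refine Finset.sum_congr rfl fun x _ => ?_
  rw [Finset.mul_sum, ← Finset.sum_sub_distrib]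
  exact Finset.sum_congr rfl fun y _ => by ring

theorem sum_sum_plus_sq (S : Finset V) (n : V → V → ℝ) (hsymm : ∀ x y, n x y = n y x) (g : V → ℝ) :
    ∑ x ∈ S, ∑ y ∈ S, n x y * (g x + g y) ^ 2 =
      2 * (∑ x ∈ S, (∑ y ∈ S, n x y) * g x ^ 2 + ∑ x ∈ S, ∑ y ∈ S, n x y * (g x * g y)) := by
  rw [mul_add, ← sum_sum_add_sq S n hsymm, Finset.mul_sum, ← Finset.sum_add_distrib]
  refine Finset.sum_congr rfl fun x _ => ?_
  rw [Finset.mul_sum, ← Finset.sum_add_distrib]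
  exact Finset.sum_congr rfl fun y _ => by ring

open scoped Classical in
/-- Cheeger's inequality with Dirichlet boundary conditions, for both ends of the spectrum. -/
theorem dirichlet_cheeger (S A : Finset V) (hA : A ⊆ S) (n : V → V → ℝ)
    (hsymm : ∀ x y, n x y = n y x) (hn : ∀ x y, 0 ≤ n x y) (φ : ℝ) (h0 : 0 ≤ φ)
    (hφ : ∀ B ⊆ A, B.Nonempty →
      φ * ∑ x ∈ B, ∑ y ∈ S, n x y ≤ ∑ x ∈ B, ∑ y ∈ S \ B, n x y)
    (g : V → ℝ) (hzero : ∀ x, x ∉ A → g x = 0) :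
    (∑ x ∈ S, ∑ y ∈ S, n x y * (g x * g y)) ^ 2 ≤
      (1 - φ ^ 2) * (∑ x ∈ S, (∑ y ∈ S, n x y) * g x ^ 2) ^ 2 := by
  have h1 := coarea_inequality S n hsymm φ _ A hA rfl hφ (fun x => g x ^ 2)
    (fun x _ => sq_nonneg _) (fun x hx => by simp [hzero x hx])
  have h2 := weighted_cauchy_schwarz S n (fun x y => (g x - g y) ^ 2) (fun x y => (g x + g y) ^ 2)
    (fun x y => |g x ^ 2 - g y ^ 2|) hn (fun _ _ => sq_nonneg _) (fun _ _ => sq_nonneg _)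
    (fun x y => by rw [sq_abs]; ring)
  rw [sum_sum_sub_sq S n hsymm, sum_sum_plus_sq S n hsymm] at h2
  set G := ∑ x ∈ S, (∑ y ∈ S, n x y) * g x ^ 2
  have hG : 0 ≤ G := Finset.sum_nonneg fun x _ =>
    mul_nonneg (Finset.sum_nonneg fun y _ => hn x y) (sq_nonneg _)
  have h3 := pow_le_pow_left₀ (by positivity) h1 2
  nlinarith

-- A self-adjoint operator has norm at most the supremum of its quadratic form, which
-- `dirichlet_cheeger` bounds by κ = √(1 − φ²). The proof polarizes: the forms at `a w + v` and `-a
-- w + v`, where `v` is the average of `w` cut off to `A`, differ by `4 a X`, and the parallelogram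
-- law adds their norms.
open scoped Classical in
theorem dirichlet_operator_bound (S A : Finset V) (hA : A ⊆ S) (n : V → V → ℝ)
    (hsymm : ∀ x y, n x y = n y x) (hn : ∀ x y, 0 ≤ n x y) (hpos : ∀ x ∈ S, 0 < ∑ y ∈ S, n x y)
    (φ : ℝ) (h0 : 0 ≤ φ)
    (hφ : ∀ B ⊆ A, B.Nonempty →
      φ * ∑ x ∈ B, ∑ y ∈ S, n x y ≤ ∑ x ∈ B, ∑ y ∈ S \ B, n x y)
    (w : V → ℝ) (hzero : ∀ x, x ∉ A → w x = 0) :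
    ∑ x ∈ A, (∑ y ∈ S, n x y * w y) ^ 2 / (∑ y ∈ S, n x y) ≤
      (1 - φ ^ 2) * ∑ x ∈ S, (∑ y ∈ S, n x y) * w x ^ 2 := by
  set m : V → ℝ := fun x => ∑ y ∈ S, n x y with hm
  set v : V → ℝ := fun x => if x ∈ A then (∑ y ∈ S, n x y * w y) / m x else 0 with hv
  have hvz : ∀ x, x ∉ A → v x = 0 := fun x hx => by simp [hv, hx]
  set X := ∑ x ∈ A, (∑ y ∈ S, n x y * w y) ^ 2 / m x with hX
  set W := ∑ x ∈ S, m x * w x ^ 2 with hW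
  have hX1 : ∑ x ∈ S, m x * v x ^ 2 = X := by
    rw [hX, ← Finset.sum_subset hA (fun x _ hx => by simp [hvz x hx])]
    refine Finset.sum_congr rfl fun x hx => ?_
    have := (hpos x (hA hx)).ne'
    simp only [hv, hx, if_true]
    field_simp
  have hX2 : ∑ x ∈ S, ∑ y ∈ S, n x y * (v x * w y) = X := by
    rw [hX, ← Finset.sum_subset hA (fun x _ hx => by simp [hvz x hx])]
    refine Finset.sum_congr rfl fun x hx => ?_
    simp only [hv, hx, if_true]
    rw [sq, mul_div_assoc, Finset.sum_mul]
    exact Finset.sum_congr rfl fun y _ => by ring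
  have hX3 : ∑ x ∈ S, ∑ y ∈ S, n x y * (w x * v y) = X := by
    rw [← hX2, Finset.sum_comm]
    exact Finset.sum_congr rfl fun x _ => Finset.sum_congr rfl fun y _ => by
      rw [hsymm]; ring
  have hX0 : 0 ≤ X := by
    rw [← hX1]
    exact Finset.sum_nonneg fun x hx => mul_nonneg (hpos x hx).le (sq_nonneg _)
  have hW0 : 0 ≤ W := Finset.sum_nonneg fun x hx => mul_nonneg (hpos x hx).le (sq_nonneg _)
  have quad : ∀ a : ℝ, ∀ g : V → ℝ, (∀ x, g x = a * w x + v x) →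
      ∑ x ∈ S, ∑ y ∈ S, n x y * (g x * g y) =
        a ^ 2 * ∑ x ∈ S, ∑ y ∈ S, n x y * (w x * w y) + 2 * a * X +
          ∑ x ∈ S, ∑ y ∈ S, n x y * (v x * v y) := by
    intro a g hg
    have : ∑ x ∈ S, ∑ y ∈ S, n x y * (g x * g y) =
        a ^ 2 * ∑ x ∈ S, ∑ y ∈ S, n x y * (w x * w y) +
        a * ∑ x ∈ S, ∑ y ∈ S, n x y * (v x * w y) + a * ∑ x ∈ S, ∑ y ∈ S, n x y * (w x * v y) +
          ∑ x ∈ S, ∑ y ∈ S, n x y * (v x * v y) := by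
      simp only [Finset.mul_sum, ← Finset.sum_add_distrib]
      exact Finset.sum_congr rfl fun x _ => Finset.sum_congr rfl fun y _ => by
        rw [hg, hg]; ring
    rw [this, hX2, hX3]; ring
  have norm : ∀ a : ℝ, ∑ x ∈ S, m x * (a * w x + v x) ^ 2 +
      ∑ x ∈ S, m x * (-a * w x + v x) ^ 2 = 2 * a ^ 2 * W + 2 * X := by
    intro a
    rw [← hX1, hW]
    simp only [Finset.mul_sum, ← Finset.sum_add_distrib]
    exact Finset.sum_congr rfl fun x _ => by ring
  have cheeger : ∀ a : ℝ, (∑ x ∈ S, ∑ y ∈ S, n x y * ((a * w x + v x) * (a * w y + v y))) ^ 2 ≤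
      (1 - φ ^ 2) * (∑ x ∈ S, m x * (a * w x + v x) ^ 2) ^ 2 := fun a =>
    dirichlet_cheeger S A hA n hsymm hn φ h0 hφ (fun x => a * w x + v x)
      (fun x hx => by simp [hzero x hx, hvz x hx])
  rcases hX0.eq_or_lt with hX00 | hXpos
  · rw [← hX00]
    rcases hW0.eq_or_lt with hW00 | hWpos
    · simp [← hW00]
    · have := dirichlet_cheeger S A hA n hsymm hn φ h0 hφ w hzero
      have h2 : 0 ≤ (1 - φ ^ 2) * W ^ 2 := (sq_nonneg _).trans this
      have h3 : 0 ≤ 1 - φ ^ 2 := nonneg_of_mul_nonneg_left h2 (by positivity)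
      positivity
  · have hκ : 0 ≤ 1 - φ ^ 2 := by
      have h1 := cheeger 0
      have h2 := (sq_nonneg _).trans h1
      simp only [zero_mul, zero_add, hX1] at h2
      exact nonneg_of_mul_nonneg_left h2 (by positivity)
    obtain ⟨κ, hκ0, hκ2⟩ : ∃ κ : ℝ, 0 ≤ κ ∧ κ ^ 2 = 1 - φ ^ 2 :=
      ⟨√(1 - φ ^ 2), Real.sqrt_nonneg _, Real.sq_sqrt hκ⟩
    have bound : ∀ a : ℝ, |∑ x ∈ S, ∑ y ∈ S, n x y * ((a * w x + v x) * (a * w y + v y))| ≤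
        κ * ∑ x ∈ S, m x * (a * w x + v x) ^ 2 := by
      intro a
      have hG : 0 ≤ ∑ x ∈ S, m x * (a * w x + v x) ^ 2 :=
        Finset.sum_nonneg fun x hx => mul_nonneg (hpos x hx).le (sq_nonneg _)
      refine abs_le_of_sq_le_sq ?_ (by positivity)
      rw [mul_pow, hκ2]
      exact cheeger a
    have main : ∀ a : ℝ, 4 * a * X ≤ κ * (2 * a ^ 2 * W + 2 * X) := by
      intro a
      have b1 := (abs_le.1 (bound a)).2
      have b2 := (abs_le.1 (bound (-a))).1
      rw [quad a _ fun _ => rfl] at b1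
      rw [quad (-a) _ fun _ => rfl] at b2
      rw [← norm a]
      linarith
    rw [← hκ2]
    rcases hκ0.eq_or_lt with hκ00 | hκpos
    · have := main 1
      rw [← hκ00] at this
      linarith
    -- With a = κ the inequality, divided by κ, becomes X ≤ κ²W.
    · have := main κ
      have h4 : 4 * X ≤ 2 * κ ^ 2 * W + 2 * X := by
        refine le_of_mul_le_mul_left ?_ hκpos
        linarith
      linarith

open scoped Classical in
/-- The key energy estimate for a reversible chain and a function supported on a set `A` all of
whose nonempty subsets have conductance at least `φ`. -/
theorem two_mul_sq_conductance_le (S A : Finset V) (hA : A ⊆ S) (n : V → V → ℝ)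
    (hsymm : ∀ x y, n x y = n y x) (hn : ∀ x y, 0 ≤ n x y) (hpos : ∀ x ∈ S, 0 < ∑ y ∈ S, n x y)
    (φ : ℝ) (h0 : 0 ≤ φ)
    (hφ : ∀ B ⊆ A, B.Nonempty →
      φ * ∑ x ∈ B, ∑ y ∈ S, n x y ≤ ∑ x ∈ B, ∑ y ∈ S \ B, n x y)
    (w : V → ℝ) (hzero : ∀ x, x ∉ A → w x = 0) :
    2 * φ ^ 2 * ∑ x ∈ S, (∑ y ∈ S, n x y) * w x ^ 2 ≤
      2 * (∑ x ∈ S, (∑ y ∈ S, n x y) * w x ^ 2 - ∑ x ∈ S, ∑ y ∈ S, n x y * (w x * w y)) +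
      (∑ x ∈ S, (∑ y ∈ S, n x y) * w x ^ 2 -
        ∑ x ∈ S, (∑ y ∈ S, n x y * w y) ^ 2 / (∑ y ∈ S, n x y)) := by
  have hop := dirichlet_operator_bound S A hA n hsymm hn hpos φ h0 hφ w hzero
  have hen := sum_sum_sub_sq S n hsymm w
  have hadd := sum_sum_add_sq S n hsymm w
  have hco := coarea_inequality S n hsymm φ _ A hA rfl hφ (fun x => w x ^ 2)
    (fun x _ => sq_nonneg _) (fun x hx => by simp [hzero x hx])
  set W := ∑ x ∈ S, (∑ y ∈ S, n x y) * w x ^ 2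
  set e := ∑ x ∈ S, ∑ y ∈ S, n x y * (w x * w y)
  -- `D` is the mass of w² that one step sends out of `A`. It enters the lower bounds for 2(W − e)
  -- and for W minus the squared norm after one step with opposite signs, and cancels in their sum.
  set D := ∑ x ∈ S \ A, ∑ y ∈ S, n x y * w y ^ 2 with hD
  have hD1 : D = ∑ x ∈ S, ∑ y ∈ S, n x y * (if x ∉ A then w y ^ 2 else 0) := by
    rw [hD, Finset.sdiff_eq_filter, Finset.sum_filter]
    refine Finset.sum_congr rfl fun x _ => ?_
    split_ifs <;> simp
  have hD2 : D = ∑ x ∈ S, ∑ y ∈ S, n x y * (if y ∉ A then w x ^ 2 else 0) := by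
    rw [hD1, Finset.sum_comm]
    exact Finset.sum_congr rfl fun x _ => Finset.sum_congr rfl fun y _ => by rw [hsymm]
  have hsplit : ∑ x ∈ S, (∑ y ∈ S, n x y * w y) ^ 2 / (∑ y ∈ S, n x y) ≤ (1 - φ ^ 2) * W + D := by
    rw [← Finset.sum_sdiff hA, add_comm]
    refine add_le_add hop (Finset.sum_le_sum fun x hx => ?_)
    have hx' : x ∈ S := (Finset.mem_sdiff.1 hx).1
    rw [div_le_iff₀ (hpos x hx'), mul_comm]
    refine Finset.sum_sq_le_sum_mul_sum_of_sq_le_mul _ (fun i _ => hn _ _)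
      (fun i _ => mul_nonneg (hn _ _) (sq_nonneg _)) fun i _ => le_of_eq (by ring)
  -- Pairs inside `A` get weights 2 and 1/2, since (w x + w y)²/2 ≤ w x² + w y². Pairs with an end
  -- outside `A` need no such loss, because one value is 0. Keeping their weight 1 produces the −2D
  -- in `ha`.
  have hcs := weighted_cauchy_schwarz S n
    (fun x y => if x ∈ A ∧ y ∈ A then 2 * (w x - w y) ^ 2 else (w x - w y) ^ 2)
    (fun x y => if x ∈ A ∧ y ∈ A then (w x + w y) ^ 2 / 2 else (w x + w y) ^ 2)
    (fun x y => |w x ^ 2 - w y ^ 2|) hn (fun _ _ => by split_ifs <;> positivity)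
    (fun _ _ => by split_ifs <;> positivity)
    (fun x y => by rw [sq_abs]; split_ifs <;> ring)
  have ha : ∑ x ∈ S, ∑ y ∈ S,
      n x y * (if x ∈ A ∧ y ∈ A then 2 * (w x - w y) ^ 2 else (w x - w y) ^ 2) =
      4 * (W - e) - 2 * D := by
    have : 4 * (W - e) - 2 * D = 2 * (2 * (W - e)) - D - D := by ring
    rw [this, ← hen]
    nth_rewrite 1 [hD1]
    rw [hD2]
    simp only [Finset.mul_sum, ← Finset.sum_sub_distrib]
    refine Finset.sum_congr rfl fun x _ => Finset.sum_congr rfl fun y _ => ?_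
    by_cases hx : x ∈ A <;> by_cases hy : y ∈ A <;> simp [hx, hy, hzero] <;> ring
  have hb : ∑ x ∈ S, ∑ y ∈ S,
      n x y * (if x ∈ A ∧ y ∈ A then (w x + w y) ^ 2 / 2 else (w x + w y) ^ 2) ≤ 2 * W := by
    rw [← hadd]
    refine Finset.sum_le_sum fun x _ => Finset.sum_le_sum fun y _ =>
      mul_le_mul_of_nonneg_left ?_ (hn x y)
    by_cases hx : x ∈ A <;> by_cases hy : y ∈ A <;> simp [hx, hy, hzero]
    nlinarith [sq_nonneg (w x - w y)]
  have hW0 : 0 ≤ W := Finset.sum_nonneg fun x hx => mul_nonneg (hpos x hx).le (sq_nonneg _)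
  have ha0 : 0 ≤ 4 * (W - e) - 2 * D := by
    rw [← ha]
    exact Finset.sum_nonneg fun x _ => Finset.sum_nonneg fun y _ =>
      mul_nonneg (hn x y) (by split_ifs <;> positivity)
  rw [ha] at hcs
  have h5 : (2 * (φ * W)) ^ 2 ≤ (4 * (W - e) - 2 * D) * (2 * W) :=
    (pow_le_pow_left₀ (by positivity) hco 2).trans
      (hcs.trans (mul_le_mul_of_nonneg_left hb ha0))
  have h6 : φ ^ 2 * W ≤ 2 * (W - e) - D := by
    rcases hW0.eq_or_lt with hW00 | hWpos
    · rw [← hW00] at ha0 ⊢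
      linarith
    · refine le_of_mul_le_mul_left ?_ hWpos
      nlinarith
  nlinarith

open scoped Classical in
/-- The `L²` contraction of a lazy reversible chain on functions supported on `A`. -/
theorem lazy_contraction (S A : Finset V) (hA : A ⊆ S) (m : V → V → ℝ)
    (hsymm : ∀ x y, m x y = m y x) (hm : ∀ x y, 0 ≤ m x y) (hpos : ∀ x ∈ S, 0 < ∑ y ∈ S, m x y)
    (γ : ℝ) (hγ0 : 0 < γ) (hγ : γ ≤ 1 / 2) (hlazy : ∀ x ∈ S, γ * ∑ y ∈ S, m x y ≤ m x x)
    (φ : ℝ) (h0 : 0 ≤ φ)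
    (hφ : ∀ B ⊆ A, B.Nonempty →
      φ * ∑ x ∈ B, ∑ y ∈ S, m x y ≤ ∑ x ∈ B, ∑ y ∈ S \ B, m x y)
    (w : V → ℝ) (hzero : ∀ x, x ∉ A → w x = 0) :
    2 * (γ ^ 2 / (1 - γ) ^ 2) * φ ^ 2 * ∑ x ∈ S, (∑ y ∈ S, m x y) * w x ^ 2 ≤
      ∑ x ∈ S, (∑ y ∈ S, m x y) * w x ^ 2 -
        ∑ x ∈ S, (∑ y ∈ S, m x y * w y) ^ 2 / (∑ y ∈ S, m x y) := by
  set d : V → ℝ := fun x => ∑ y ∈ S, m x y with hd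
  have hγ1 : 0 < 1 - γ := by linarith
  -- Strip off the guaranteed holding probability: m = γ d I + (1 − γ) n, where `n` has the same row
  -- sums on `S` and conductances larger by the factor 1/(1 − γ).
  set n : V → V → ℝ := fun x y =>
    if x ∈ S then (if y ∈ S then (m x y - (if x = y then γ * d x else 0)) / (1 - γ) else 0) else 0
    with hn
  have hnS : ∀ x ∈ S, ∀ y ∈ S, n x y = (m x y - (if x = y then γ * d x else 0)) / (1 - γ) :=
    fun x hx y hy => by simp [hn, hx, hy]
  have hnsymm : ∀ x y, n x y = n y x := by
    intro x y
    simp only [hn]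
    by_cases hx : x ∈ S <;> by_cases hy : y ∈ S <;> simp only [hx, hy, if_true, if_false]
    rw [hsymm x y]
    by_cases hxy : x = y
    · subst hxy; rfl
    · simp [hxy, Ne.symm hxy]
  have hn0 : ∀ x y, 0 ≤ n x y := by
    intro x y
    simp only [hn]
    split_ifs with hx hy hxy
    · subst hxy
      exact div_nonneg (by linarith [hlazy x hx]) hγ1.le
    · exact div_nonneg (by linarith [hm x y]) hγ1.le
    · exact le_rfl
    · exact le_rfl
  have hsum : ∀ x ∈ S, ∀ f : V → ℝ, ∑ y ∈ S, n x y * f y =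
      (∑ y ∈ S, m x y * f y - γ * d x * f x) / (1 - γ) := by
    intro x hx f
    rw [Finset.sum_congr rfl fun y hy => by rw [hnS x hx y hy]]
    simp only [div_mul_eq_mul_div, ← Finset.sum_div, sub_mul, Finset.sum_sub_distrib, ite_mul,
      zero_mul, Finset.sum_ite_eq, hx, if_true]
  have hdeg : ∀ x ∈ S, ∑ y ∈ S, n x y = d x := by
    intro x hx
    have := hsum x hx fun _ => 1
    simp only [mul_one] at this
    rw [this, div_eq_iff hγ1.ne']
    simp only [hd]
    ring
  have hflow : ∀ B ⊆ A, B.Nonempty → φ / (1 - γ) * ∑ x ∈ B, ∑ y ∈ S, n x y ≤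
      ∑ x ∈ B, ∑ y ∈ S \ B, n x y := by
    intro B hB hBne
    have h1 : ∑ x ∈ B, ∑ y ∈ S, n x y = ∑ x ∈ B, d x :=
      Finset.sum_congr rfl fun x hx => hdeg x (hA (hB hx))
    have h2 : ∑ x ∈ B, ∑ y ∈ S \ B, n x y = (∑ x ∈ B, ∑ y ∈ S \ B, m x y) / (1 - γ) := by
      rw [Finset.sum_div]
      refine Finset.sum_congr rfl fun x hx => ?_
      rw [Finset.sum_div]
      refine Finset.sum_congr rfl fun y hy => ?_
      have hy' := Finset.mem_sdiff.1 hy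
      have hxy : x ≠ y := fun h => hy'.2 (h ▸ hx)
      rw [hnS x (hA (hB hx)) y hy'.1]
      simp [hxy]
    rw [h1, h2, div_mul_eq_mul_div]
    exact div_le_div_of_nonneg_right (hφ B hB hBne) hγ1.le
  have key := two_mul_sq_conductance_le S A hA n hnsymm hn0
    (fun x hx => by rw [hdeg x hx]; exact hpos x hx) (φ / (1 - γ)) (by positivity) hflow w hzero
  have hWW : ∑ x ∈ S, (∑ y ∈ S, n x y) * w x ^ 2 = ∑ x ∈ S, d x * w x ^ 2 :=
    Finset.sum_congr rfl fun x hx => by rw [hdeg x hx]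
  have hee : ∑ x ∈ S, ∑ y ∈ S, n x y * (w x * w y) =
      ∑ x ∈ S, w x * ∑ y ∈ S, n x y * w y := by
    refine Finset.sum_congr rfl fun x _ => ?_
    rw [Finset.mul_sum]
    exact Finset.sum_congr rfl fun y _ => by ring
  have hQQ : ∑ x ∈ S, (∑ y ∈ S, n x y * w y) ^ 2 / (∑ y ∈ S, n x y) =
      ∑ x ∈ S, (∑ y ∈ S, n x y * w y) ^ 2 / d x :=
    Finset.sum_congr rfl fun x hx => by rw [hdeg x hx]
  rw [hWW, hee, hQQ] at key
  set W := ∑ x ∈ S, d x * w x ^ 2 with hW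
  set e := ∑ x ∈ S, w x * ∑ y ∈ S, n x y * w y with he
  set q := ∑ x ∈ S, (∑ y ∈ S, n x y * w y) ^ 2 / d x with hq
  -- As γ ≤ 1 − γ and W − q ≥ 0, the right side is at least γ(1 − γ) times the combination 2(W − e)
  -- + (W − q) bounded in `two_mul_sq_conductance_le`.
  have hexp : W - ∑ x ∈ S, (∑ y ∈ S, m x y * w y) ^ 2 / d x =
      2 * γ * (1 - γ) * (W - e) + (1 - γ) ^ 2 * (W - q) := by
    have : ∑ x ∈ S, (∑ y ∈ S, m x y * w y) ^ 2 / d x =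
        γ ^ 2 * W + 2 * γ * (1 - γ) * e + (1 - γ) ^ 2 * q := by
      rw [hW, he, hq]
      simp only [Finset.mul_sum (s := S) (a := γ ^ 2), Finset.mul_sum (s := S) (a := (1 - γ) ^ 2),
        Finset.mul_sum (s := S) (a := 2 * γ * (1 - γ)), ← Finset.sum_add_distrib]
      refine Finset.sum_congr rfl fun x hx => ?_
      have hx0 : d x ≠ 0 := (hpos x hx).ne'
      have : ∑ y ∈ S, m x y * w y = γ * d x * w x + (1 - γ) * ∑ y ∈ S, n x y * w y := by
        rw [hsum x hx w]; field_simp; ring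
      rw [this]
      field_simp
      ring
    rw [this]; ring
  have hWq : 0 ≤ W - q := by
    have : q ≤ ∑ x ∈ S, ∑ y ∈ S, n x y * w y ^ 2 := by
      refine Finset.sum_le_sum fun x hx => ?_
      rw [div_le_iff₀ (hpos x hx), mul_comm, show (∑ y ∈ S, m x y) = ∑ y ∈ S, n x y from
        (hdeg x hx).symm]
      exact Finset.sum_sq_le_sum_mul_sum_of_sq_le_mul _ (fun i _ => hn0 _ _)
        (fun i _ => mul_nonneg (hn0 _ _) (sq_nonneg _)) fun i _ => le_of_eq (by ring)
    have h2 : ∑ x ∈ S, ∑ y ∈ S, n x y * w y ^ 2 = W := by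
      rw [Finset.sum_comm, ← hWW]
      refine Finset.sum_congr rfl fun x _ => ?_
      rw [Finset.sum_mul]
      exact Finset.sum_congr rfl fun y _ => by rw [hnsymm]
    linarith
  have hW0 : 0 ≤ W := Finset.sum_nonneg fun x hx => mul_nonneg (hpos x hx).le (sq_nonneg _)
  rw [hexp]
  have h1 : γ * (1 - γ) * (2 * (φ / (1 - γ)) ^ 2 * W) ≤
      γ * (1 - γ) * (2 * (W - e) + (W - q)) :=
    mul_le_mul_of_nonneg_left key (by positivity)
  have h2 : γ * (1 - γ) * (2 * (φ / (1 - γ)) ^ 2 * W) = γ * (1 - γ) * (2 * (φ ^ 2 / (1 - γ) ^ 2) * W) := by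
    rw [div_pow]
  have h3 : 2 * (γ ^ 2 / (1 - γ) ^ 2) * φ ^ 2 * W ≤
      γ * (1 - γ) * (2 * (φ ^ 2 / (1 - γ) ^ 2) * W) := by
    have : γ ^ 2 ≤ γ * (1 - γ) := by nlinarith
    calc 2 * (γ ^ 2 / (1 - γ) ^ 2) * φ ^ 2 * W = γ ^ 2 * (2 * (φ ^ 2 / (1 - γ) ^ 2) * W) := by ring
      _ ≤ _ := mul_le_mul_of_nonneg_right this (by positivity)
  have h4 : γ * (1 - γ) * (W - q) ≤ (1 - γ) ^ 2 * (W - q) :=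
    mul_le_mul_of_nonneg_right (by nlinarith) hWq
  linarith

end Dirichlet

/-! ### Truncated Bregman distance of the p-th power. -/

section Convexity

theorem rpow_tangent_le {p s a : ℝ} (hp : 2 ≤ p) (hs : 0 ≤ s) (ha : 0 ≤ a) :
    a ^ p + p * a ^ (p - 1) * (s - a) ≤ s ^ p := by
  rcases ha.eq_or_lt with rfl | ha
  · rw [Real.zero_rpow (by linarith), Real.zero_rpow (by linarith)]
    simpa using Real.rpow_nonneg hs p
  · have h := one_add_mul_self_le_rpow_one_add (s := s / a - 1) (by
      have : 0 ≤ s / a := by positivity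
      linarith) (p := p) (by linarith)
    rw [add_sub_cancel, Real.div_rpow hs ha.le, le_div_iff₀ (by positivity)] at h
    rw [Real.rpow_sub_one ha.ne']
    calc a ^ p + p * (a ^ p / a) * (s - a) = (1 + p * (s / a - 1)) * a ^ p := by
          field_simp
      _ ≤ s ^ p := h

theorem convexOn_of_supporting_lines {K : ℝ → ℝ} {s : Set ℝ} (hs : Convex ℝ s)
    (h : ∀ a ∈ s, ∃ c, ∀ x ∈ s, K a + c * (x - a) ≤ K x) : ConvexOn ℝ s K := by
  refine ⟨hs, fun x hx y hy u v hu hv huv => ?_⟩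
  obtain ⟨c, hc⟩ := h _ (hs hx hy hu hv huv)
  have h1 := mul_le_mul_of_nonneg_left (hc x hx) hu
  have h2 := mul_le_mul_of_nonneg_left (hc y hy) hv
  simp only [smul_eq_mul] at *
  have hu' : u = 1 - v := by linarith
  subst hu'
  linarith

/-- The Bregman distance of `x ↦ x ^ p` from the point `t`, set to `0` to the left of `t`. -/
noncomputable def truncBregman (p t s : ℝ) : ℝ :=
  max s t ^ p - t ^ p - p * t ^ (p - 1) * (max s t - t)

theorem truncBregman_of_le {p t s : ℝ} (h : s ≤ t) : truncBregman p t s = 0 := by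
  simp [truncBregman, max_eq_right h]

theorem truncBregman_of_ge {p t s : ℝ} (h : t ≤ s) :
    truncBregman p t s = s ^ p - t ^ p - p * t ^ (p - 1) * (s - t) := by
  simp [truncBregman, max_eq_left h]

theorem truncBregman_nonneg {p t s : ℝ} (hp : 2 ≤ p) (ht : 0 < t) : 0 ≤ truncBregman p t s := by
  have := rpow_tangent_le hp (ht.le.trans (le_max_right s t)) ht.le
  unfold truncBregman
  linarith

/-- The function follows s^p up to `t` and its tangent line at `t` afterwards. -/
theorem convexOn_rpow_sub_truncBregman {p t : ℝ} (hp : 2 ≤ p) (ht : 0 < t) :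
    ConvexOn ℝ (Set.Ici 0) fun s => s ^ p - truncBregman p t s := by
  refine convexOn_of_supporting_lines (convex_Ici 0) fun a ha => ?_
  have ha0 : 0 ≤ a := ha
  rcases le_total a t with hat | hat
  · refine ⟨p * a ^ (p - 1), fun x hx => ?_⟩
    have hx0 : 0 ≤ x := hx
    simp only [truncBregman_of_le hat]
    rcases le_total x t with hxt | hxt
    · rw [truncBregman_of_le hxt]
      linarith [rpow_tangent_le hp hx0 ha0]
    · rw [truncBregman_of_ge hxt]
      have h1 := rpow_tangent_le hp ht.le ha0
      have h2 : p * a ^ (p - 1) * (x - t) ≤ p * t ^ (p - 1) * (x - t) := by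
        have := Real.rpow_le_rpow ha0 hat (z := p - 1) (by linarith)
        have hxt' : 0 ≤ x - t := by linarith
        gcongr
      linarith
  · refine ⟨p * t ^ (p - 1), fun x hx => ?_⟩
    have hx0 : 0 ≤ x := hx
    simp only [truncBregman_of_ge hat]
    rcases le_total x t with hxt | hxt
    · rw [truncBregman_of_le hxt]
      linarith [rpow_tangent_le hp hx0 ht.le]
    · rw [truncBregman_of_ge hxt]
      linarith

/-- With B the Bregman distance this is (B′)² ≤ 2BB″, the condition for √B to be convex. The
difference 2BB″ − (B′)² vanishes at `t` and has derivative 2BB‴, which is nonnegative because p ≥ 2.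
-/
theorem bregman_log_derivative_bound {p t s : ℝ} (hp : 2 ≤ p) (ht : 0 < t) (hts : t ≤ s) :
    (p * (s ^ (p - 1) - t ^ (p - 1))) ^ 2 ≤
      2 * (s ^ p - t ^ p - p * t ^ (p - 1) * (s - t)) * (p * ((p - 1) * s ^ (p - 2))) := by
  set E : ℝ → ℝ := fun s =>
    2 * (s ^ p - t ^ p - p * t ^ (p - 1) * (s - t)) * (p * ((p - 1) * s ^ (p - 2))) -
      (p * (s ^ (p - 1) - t ^ (p - 1))) ^ 2 with hE
  have hderiv : ∀ x, t ≤ x → HasDerivAt E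
      (2 * (x ^ p - t ^ p - p * t ^ (p - 1) * (x - t)) *
        (p * ((p - 1) * ((p - 2) * x ^ (p - 2 - 1))))) x := by
    intro x hx
    have hx0 : x ≠ 0 := (ht.trans_le hx).ne'
    have d0 := Real.hasDerivAt_rpow_const (x := x) (p := p) (Or.inl hx0)
    have d1 := Real.hasDerivAt_rpow_const (x := x) (p := p - 1) (Or.inl hx0)
    have d2 := Real.hasDerivAt_rpow_const (x := x) (p := p - 2) (Or.inl hx0)
    have hB := ((d0.sub_const (t ^ p)).sub
      (((hasDerivAt_id x).sub_const t).const_mul (p * t ^ (p - 1)))).const_mul 2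
    have h := (hB.mul ((d2.const_mul (p - 1)).const_mul p)).sub
      (((d1.sub_const (t ^ (p - 1))).const_mul p).pow 2)
    refine h.congr_deriv ?_
    rw [show p - 1 - 1 = p - 2 by ring]
    simp
    ring
  have hmono : MonotoneOn E (Set.Ici t) := by
    refine monotoneOn_of_deriv_nonneg (convex_Ici t)
      (fun x hx => (hderiv x hx).continuousAt.continuousWithinAt)
      (fun x hx => (hderiv x (by rw [interior_Ici] at hx; exact le_of_lt hx)).differentiableAt
        |>.differentiableWithinAt) fun x hx => ?_
    rw [interior_Ici] at hx
    have hx' : t ≤ x := le_of_lt hx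
    rw [(hderiv x hx').deriv]
    have h1 := rpow_tangent_le hp (ht.le.trans hx') ht.le
    have h2 : 0 ≤ x ^ (p - 2 - 1) := Real.rpow_nonneg (ht.le.trans hx') _
    have h3 : 0 ≤ x ^ p - t ^ p - p * t ^ (p - 1) * (x - t) := by linarith
    have h4 : 0 ≤ p := by linarith
    have h5 : 0 ≤ p - 1 := by linarith
    have h6 : 0 ≤ p - 2 := by linarith
    positivity
  have := hmono (Set.mem_Ici.2 le_rfl) (Set.mem_Ici.2 hts) hts
  simp only [hE] at this
  simp at this
  linarith

theorem convexOn_sqrt_bregman {p t : ℝ} (hp : 2 ≤ p) (ht : 0 < t) :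
    ConvexOn ℝ (Set.Ici t) fun s => √(s ^ p - t ^ p - p * t ^ (p - 1) * (s - t)) := by
  set B : ℝ → ℝ := fun s => s ^ p - t ^ p - p * t ^ (p - 1) * (s - t) with hB
  have hBpos : ∀ s, t < s → 0 < B s := by
    intro s hs
    have hs0 : 0 < s := ht.trans hs
    have h := one_add_mul_self_lt_rpow_one_add (s := s / t - 1) (by
      have : 0 < s / t := by positivity
      linarith) (by
      have : 1 < s / t := by rw [lt_div_iff₀ ht]; linarith
      linarith) (p := p) (by linarith)
    rw [add_sub_cancel, Real.div_rpow hs0.le ht.le, lt_div_iff₀ (by positivity)] at h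
    have h2 : p * t ^ (p - 1) * (s - t) = p * (s / t - 1) * t ^ p := by
      rw [Real.rpow_sub_one ht.ne']; field_simp
    simp only [hB]
    rw [h2]; linarith
  have hBd : ∀ s, t < s → HasDerivAt B (p * (s ^ (p - 1) - t ^ (p - 1))) s := by
    intro s hs
    have hs0 : s ≠ 0 := (ht.trans hs).ne'
    have d0 := Real.hasDerivAt_rpow_const (x := s) (p := p) (Or.inl hs0)
    refine ((d0.sub_const (t ^ p)).sub
      (((hasDerivAt_id s).sub_const t).const_mul (p * t ^ (p - 1)))).congr_deriv ?_
    ring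
  have hd : ∀ s, t < s → HasDerivAt (fun s => √(B s))
      (p * (s ^ (p - 1) - t ^ (p - 1)) / (2 * √(B s))) s :=
    fun s hs => (hBd s hs).sqrt (hBpos s hs).ne'
  have hBcont : ContinuousOn B (Set.Ici t) := by
    have : ContinuousOn (fun s : ℝ => s ^ p) (Set.Ici t) :=
      fun s hs => (Real.continuousAt_rpow_const s p
        (Or.inl (ht.trans_le hs).ne')).continuousWithinAt
    simp only [hB]
    fun_prop
  refine MonotoneOn.convexOn_of_deriv (convex_Ici t) hBcont.sqrt
    (fun s hs => (hd s (by rwa [interior_Ici] at hs)).differentiableAt.differentiableWithinAt) ?_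
  rw [interior_Ici]
  have hmono : MonotoneOn (fun s => p * (s ^ (p - 1) - t ^ (p - 1)) / (2 * √(B s))) (Set.Ioi t) := by
    have hdd : ∀ s, t < s → HasDerivAt (fun s => p * (s ^ (p - 1) - t ^ (p - 1)) / (2 * √(B s)))
        ((p * ((p - 1) * s ^ (p - 2)) * (2 * √(B s)) - p * (s ^ (p - 1) - t ^ (p - 1)) *
          (2 * (p * (s ^ (p - 1) - t ^ (p - 1)) / (2 * √(B s))))) / (2 * √(B s)) ^ 2) s := by
      intro s hs
      have hs0 : s ≠ 0 := (ht.trans hs).ne'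
      have d1 := Real.hasDerivAt_rpow_const (x := s) (p := p - 1) (Or.inl hs0)
      rw [show p - 1 - 1 = p - 2 by ring] at d1
      have hne : 2 * √(B s) ≠ 0 := by
        have := Real.sqrt_pos.2 (hBpos s hs)
        positivity
      exact ((d1.sub_const (t ^ (p - 1))).const_mul p).div ((hd s hs).const_mul 2) hne
    refine monotoneOn_of_deriv_nonneg (convex_Ioi t)
      (fun s hs => (hdd s hs).continuousAt.continuousWithinAt)
      (fun s hs => (hdd s (by rwa [interior_Ioi] at hs)).differentiableAt.differentiableWithinAt)
      fun s hs => ?_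
    rw [interior_Ioi] at hs
    have hs' : t < s := hs
    rw [(hdd s hs').deriv]
    have hsq := Real.sqrt_pos.2 (hBpos s hs')
    refine div_nonneg ?_ (sq_nonneg _)
    have key := bregman_log_derivative_bound hp ht hs'.le
    have hsq2 : √(B s) ^ 2 = s ^ p - t ^ p - p * t ^ (p - 1) * (s - t) :=
      Real.sq_sqrt (hBpos s hs').le
    rw [← hsq2] at key
    set r := √(B s)
    set b := p * (s ^ (p - 1) - t ^ (p - 1))
    have : p * ((p - 1) * s ^ (p - 2)) * (2 * r) - b * (2 * (b / (2 * r))) =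
        (2 * r ^ 2 * (p * ((p - 1) * s ^ (p - 2))) - b ^ 2) / r := by
      field_simp
    rw [this]
    exact div_nonneg (by linarith) hsq.le
  intro x hx y hy hxy
  rw [(hd x hx).deriv, (hd y hy).deriv]
  exact hmono hx hy hxy

theorem convexOn_sqrt_truncBregman {p t : ℝ} (hp : 2 ≤ p) (ht : 0 < t) :
    ConvexOn ℝ (Set.Ici 0) fun s => √(truncBregman p t s) := by
  have himg : (fun s : ℝ => max s t) '' Set.Ici 0 = Set.Ici t := by
    ext x
    constructor
    · rintro ⟨s, -, rfl⟩
      exact le_max_right s t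
    · intro hx
      exact ⟨x, ht.le.trans hx, max_eq_left hx⟩
  have hmax : ConvexOn ℝ (Set.Ici (0 : ℝ)) fun s => max s t :=
    (convexOn_id (convex_Ici 0)).sup (convexOn_const t (convex_Ici 0))
  have hc := convexOn_sqrt_bregman hp ht
  refine ConvexOn.comp (f := fun s => max s t)
    (g := fun s => √(s ^ p - t ^ p - p * t ^ (p - 1) * (s - t))) (by rwa [himg]) hmax ?_
  rw [himg]
  intro x hx y hy hxy
  have hx' : t ≤ x := hx
  refine Real.sqrt_le_sqrt ?_
  have h1 := rpow_tangent_le hp (ht.le.trans (hx'.trans hxy)) (ht.le.trans hx')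
  have h2 : p * t ^ (p - 1) * (y - x) ≤ p * x ^ (p - 1) * (y - x) := by
    have := Real.rpow_le_rpow ht.le hx' (z := p - 1) (by linarith)
    have : 0 ≤ y - x := by linarith
    gcongr
  linarith

/-- Above `t` the left side is the tangent line at `t`. Evaluated at s/4 instead of s, that line
lies below (s/4)^p, and the two evaluations differ by the linear term. -/
theorem rpow_sub_truncBregman_le {p t s : ℝ} (hp : 2 ≤ p) (ht : 0 < t) (hs : 0 ≤ s) :
    s ^ p - truncBregman p t s ≤ 3 * p / 4 * t ^ (p - 1) * s + (s / 4) ^ p := by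
  rcases le_total s t with hst | hst
  · rw [truncBregman_of_le hst, sub_zero]
    have h1 : s ^ p ≤ t ^ (p - 1) * s := by
      rcases hs.eq_or_lt with rfl | hs
      · rw [Real.zero_rpow (by linarith)]; simp
      · calc s ^ p = s ^ (p - 1) * s := by rw [Real.rpow_sub_one hs.ne']; field_simp
          _ ≤ _ := mul_le_mul_of_nonneg_right (Real.rpow_le_rpow hs.le hst (by linarith)) hs.le
    have h2 : 0 ≤ (s / 4) ^ p := by positivity
    have h3 : 0 ≤ t ^ (p - 1) * s := by positivity
    nlinarith
  · rw [truncBregman_of_ge hst]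
    have h := rpow_tangent_le (s := s / 4) hp (by positivity) ht.le
    linear_combination h

theorem rpow_two_sub_truncBregman_le {t s : ℝ} (ht : 0 < t) (hs : 0 ≤ s) :
    s ^ (2 : ℝ) - truncBregman 2 t s ≤ 2 * t * s := by
  rcases le_total s t with hst | hst
  · rw [truncBregman_of_le hst, sub_zero, Real.rpow_two]
    nlinarith
  · rw [truncBregman_of_ge hst, Real.rpow_two, Real.rpow_two, show (2 : ℝ) - 1 = 1 by norm_num,
      Real.rpow_one]
    nlinarith

theorem three_mul_add_one_div_four_le {p : ℝ} (hp : 2 ≤ p) : (3 * p + 1) / 4 ≤ 2 ^ p / p := by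
  rw [le_div_iff₀ (by linarith)]
  obtain ⟨x, rfl⟩ : ∃ x, p = 2 + x := ⟨p - 2, by ring⟩
  have hx : 0 ≤ x := by linarith
  rw [Real.rpow_add (by norm_num), Real.rpow_two, Real.rpow_def_of_pos (by norm_num : (0 : ℝ) < 2)]
  have hl : 0.69 ≤ Real.log 2 := by linarith [Real.log_two_gt_d9]
  have h1 := Real.quadratic_le_exp_of_nonneg (mul_nonneg (by linarith : 0 ≤ Real.log 2) hx)
  have h2 : 0.69 * x ≤ Real.log 2 * x := mul_le_mul_of_nonneg_right hl hx
  have h3 : (0.69 * x) ^ 2 ≤ (Real.log 2 * x) ^ 2 := pow_le_pow_left₀ (by positivity) h2 2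
  -- After the quadratic lower bound for the exponential, what remains is a positive quadratic in
  -- `x` with its minimum near 1.213.
  nlinarith [sq_nonneg (x - 1.213)]

end Convexity

/-! ### Decay of the p-th power sum in one step, and the truncation loss. -/

section Contraction

variable {V : Type*}

theorem jensen_row (S : Finset V) (m : V → ℝ) (hm : ∀ y, 0 ≤ m y) (hpos : 0 < ∑ y ∈ S, m y)
    {K : ℝ → ℝ} (hK : ConvexOn ℝ (Set.Ici 0) K) (h : V → ℝ) (hh : ∀ x, 0 ≤ h x) :
    K ((∑ y ∈ S, m y * h y) / ∑ y ∈ S, m y) ≤ (∑ y ∈ S, m y * K (h y)) / ∑ y ∈ S, m y := by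
  have := hK.map_sum_le (t := S) (w := fun y => m y / ∑ y ∈ S, m y) (p := h)
    (fun y _ => div_nonneg (hm y) hpos.le) (by rw [← Finset.sum_div, div_self hpos.ne'])
    (fun y _ => hh y)
  simpa only [smul_eq_mul, div_mul_eq_mul_div, ← Finset.sum_div] using this

theorem jensen_reversible (S : Finset V) (m : V → V → ℝ) (hsymm : ∀ x y, m x y = m y x)
    (hm : ∀ x y, 0 ≤ m x y) (hpos : ∀ x ∈ S, 0 < ∑ y ∈ S, m x y)
    {K : ℝ → ℝ} (hK : ConvexOn ℝ (Set.Ici 0) K) (h : V → ℝ) (hh : ∀ x, 0 ≤ h x) :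
    ∑ x ∈ S, (∑ y ∈ S, m x y) * K ((∑ y ∈ S, m x y * h y) / ∑ y ∈ S, m x y) ≤
      ∑ x ∈ S, (∑ y ∈ S, m x y) * K (h x) := by
  calc _ ≤ ∑ x ∈ S, ∑ y ∈ S, m x y * K (h y) := by
        refine Finset.sum_le_sum fun x hx => ?_
        have := jensen_row S (m x) (hm x) (hpos x hx) hK h hh
        rwa [le_div_iff₀ (hpos x hx), mul_comm] at this
    _ = _ := by
        rw [Finset.sum_comm]
        refine Finset.sum_congr rfl fun x _ => ?_
        rw [Finset.sum_mul]
        exact Finset.sum_congr rfl fun y _ => by rw [hsymm]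

open scoped Classical in
/-- The decay of `∑ π h ^ p` under one step of a lazy reversible chain. -/
theorem rpow_contraction (S : Finset V) (m : V → V → ℝ)
    (hsymm : ∀ x y, m x y = m y x) (hm : ∀ x y, 0 ≤ m x y) (hpos : ∀ x ∈ S, 0 < ∑ y ∈ S, m x y)
    (γ : ℝ) (hγ0 : 0 < γ) (hγ : γ ≤ 1 / 2) (hlazy : ∀ x ∈ S, γ * ∑ y ∈ S, m x y ≤ m x x)
    (φ : ℝ) (h0 : 0 ≤ φ) {p t : ℝ} (hp : 2 ≤ p) (ht : 0 < t) (h : V → ℝ) (hh : ∀ x, 0 ≤ h x)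
    (hφ : ∀ B ⊆ S, (∀ x ∈ B, t < h x) → B.Nonempty →
      φ * ∑ x ∈ B, ∑ y ∈ S, m x y ≤ ∑ x ∈ B, ∑ y ∈ S \ B, m x y) :
    ∑ x ∈ S, (∑ y ∈ S, m x y) * ((∑ y ∈ S, m x y * h y) / ∑ y ∈ S, m x y) ^ p ≤
      ∑ x ∈ S, (∑ y ∈ S, m x y) * h x ^ p - 2 * (γ ^ 2 / (1 - γ) ^ 2) * φ ^ 2 *
        ∑ x ∈ S, (∑ y ∈ S, m x y) * truncBregman p t (h x) := by
  set d : V → ℝ := fun x => ∑ y ∈ S, m x y with hd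
  set P : V → ℝ := fun x => (∑ y ∈ S, m x y * h y) / ∑ y ∈ S, m x y with hP
  have hB0 : ∀ x, 0 ≤ truncBregman p t x := fun x => truncBregman_nonneg hp ht
  -- Split s^p into s^p − B and B. Jensen handles the first directly; for B, Jensen applied to √B
  -- leaves a squared average, to which the L² contraction applies.
  have j1 := jensen_reversible S m hsymm hm hpos (convexOn_rpow_sub_truncBregman hp ht) h hh
  have j2 : ∑ x ∈ S, d x * truncBregman p t (P x) ≤
      ∑ x ∈ S, (∑ y ∈ S, m x y * √(truncBregman p t (h y))) ^ 2 / d x := by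
    refine Finset.sum_le_sum fun x hx => ?_
    have hdx : 0 < d x := hpos x hx
    have := jensen_row S (m x) (hm x) hdx (convexOn_sqrt_truncBregman hp ht) h hh
    have h2 := pow_le_pow_left₀ (Real.sqrt_nonneg _) this 2
    rw [Real.sq_sqrt (hB0 _), div_pow] at h2
    calc d x * truncBregman p t (P x) ≤
          d x * ((∑ y ∈ S, m x y * √(truncBregman p t (h y))) ^ 2 / d x ^ 2) :=
          mul_le_mul_of_nonneg_left h2 hdx.le
      _ = _ := by field_simp
  set w : V → ℝ := fun x => if x ∈ S then √(truncBregman p t (h x)) else 0 with hw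
  have hwS : ∀ x ∈ S, w x = √(truncBregman p t (h x)) := fun x hx => by simp [hw, hx]
  have c := lazy_contraction S (S.filter fun x => t < h x) (Finset.filter_subset _ _) m hsymm hm
    hpos γ hγ0 hγ hlazy φ h0
    (fun B hB => hφ B (hB.trans (Finset.filter_subset _ _))
      fun x hx => (Finset.mem_filter.1 (hB hx)).2) w
    (fun x hx => by
      by_cases hxS : x ∈ S
      · rw [hwS x hxS]
        have : h x ≤ t := by
          by_contra hcon
          exact hx (Finset.mem_filter.2 ⟨hxS, not_le.1 hcon⟩)
        rw [truncBregman_of_le this, Real.sqrt_zero]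
      · simp [hw, hxS])
  have e1 : ∑ x ∈ S, d x * w x ^ 2 = ∑ x ∈ S, d x * truncBregman p t (h x) :=
    Finset.sum_congr rfl fun x hx => by rw [hwS x hx, Real.sq_sqrt (hB0 _)]
  have e2 : ∑ x ∈ S, (∑ y ∈ S, m x y * w y) ^ 2 / d x =
      ∑ x ∈ S, (∑ y ∈ S, m x y * √(truncBregman p t (h y))) ^ 2 / d x := by
    refine Finset.sum_congr rfl fun x _ => ?_
    rw [Finset.sum_congr rfl fun y hy => by rw [hwS y hy]]
  rw [e1, e2] at c
  simp only [mul_sub, Finset.sum_sub_distrib] at j1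
  linarith

theorem sum_rpow_sub_truncBregman_le (S : Finset V) (d h : V → ℝ) (hd : ∀ x ∈ S, 0 ≤ d x)
    (hh : ∀ x, 0 ≤ h x) {p t : ℝ} (hp : 2 ≤ p) (ht : 0 < t) (hmass : ∑ x ∈ S, d x * h x ≤ 1)
    (hnorm : ∑ x ∈ S, d x * h x ^ p ≤ 2 ^ p * t ^ (p - 1)) :
    ∑ x ∈ S, d x * (h x ^ p - truncBregman p t (h x)) ≤ 2 ^ p / p * t ^ (p - 1) := by
  have hT : 0 < t ^ (p - 1) := by positivity
  calc ∑ x ∈ S, d x * (h x ^ p - truncBregman p t (h x))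
      ≤ ∑ x ∈ S, d x * (3 * p / 4 * t ^ (p - 1) * h x + (h x / 4) ^ p) :=
        Finset.sum_le_sum fun x hx =>
          mul_le_mul_of_nonneg_left (rpow_sub_truncBregman_le hp ht (hh x)) (hd x hx)
    _ = 3 * p / 4 * t ^ (p - 1) * ∑ x ∈ S, d x * h x + (1 / 4) ^ p * ∑ x ∈ S, d x * h x ^ p := by
        rw [Finset.mul_sum, Finset.mul_sum, ← Finset.sum_add_distrib]
        refine Finset.sum_congr rfl fun x _ => ?_
        rw [div_eq_mul_one_div (h x), Real.mul_rpow (hh x) (by norm_num)]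
        ring
    _ ≤ 3 * p / 4 * t ^ (p - 1) * 1 + (1 / 4) ^ p * (2 ^ p * t ^ (p - 1)) := by
        have : 0 ≤ p := by linarith
        gcongr
    _ = (3 * p / 4 + (1 / 2) ^ p) * t ^ (p - 1) := by
        rw [← mul_assoc, ← Real.mul_rpow (by norm_num) (by norm_num)]
        norm_num
        ring
    _ ≤ (3 * p + 1) / 4 * t ^ (p - 1) := by
        have : (1 / 2 : ℝ) ^ p ≤ (1 / 2) ^ (2 : ℝ) :=
          Real.rpow_le_rpow_of_exponent_ge (by norm_num) (by norm_num) hp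
        rw [Real.rpow_two] at this
        refine mul_le_mul_of_nonneg_right ?_ hT.le
        linarith
    _ ≤ _ := mul_le_mul_of_nonneg_right (three_mul_add_one_div_four_le hp) hT.le

/-- The part of `∑ π h ^ p` which is lost by truncation at the level `t` is at most the fraction
`1 - (p - 1) α`, where `p = max 2 α⁻¹`. -/
theorem truncation_loss_le (S : Finset V) (d h : V → ℝ) (hd : ∀ x ∈ S, 0 ≤ d x)
    (hh : ∀ x, 0 ≤ h x) {α t : ℝ} (h0 : 0 < α) (h1 : α < 1) (ht : 0 < t)
    (hmass : ∑ x ∈ S, d x * h x ≤ 1)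
    (hnorm : ∑ x ∈ S, d x * h x ^ (max 2 α⁻¹) ≤
      2 ^ ((max 2 α⁻¹ - 1) / (1 - α)) * t ^ (max 2 α⁻¹ - 1)) :
    ∑ x ∈ S, d x * (h x ^ (max 2 α⁻¹) - truncBregman (max 2 α⁻¹) t (h x)) ≤
      (1 - (max 2 α⁻¹ - 1) * α) *
        (2 ^ ((max 2 α⁻¹ - 1) / (1 - α)) * t ^ (max 2 α⁻¹ - 1)) := by
  have h1' : 0 < 1 - α := by linarith
  rcases le_total 2 α⁻¹ with h2 | h2
  -- Here p = 1/α, so κ = p and 1 − (p − 1)α = 1/p.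
  · rw [max_eq_right h2] at hnorm ⊢
    have hκ : (α⁻¹ - 1) / (1 - α) = α⁻¹ := by
      rw [div_eq_iff h1'.ne']; field_simp
    rw [hκ] at hnorm ⊢
    refine (sum_rpow_sub_truncBregman_le S d h hd hh h2 ht hmass hnorm).trans (le_of_eq ?_)
    field_simp
    ring
  · rw [max_eq_left h2] at hnorm ⊢
    have e1 : (2 : ℝ) - 1 = 1 := by norm_num
    rw [e1, Real.rpow_one] at hnorm ⊢
    rw [one_mul]
    have hb : (1 : ℝ) ≤ 1 / (1 - α) - 1 := by
      have : (2⁻¹ : ℝ) ≤ α := by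
        rw [inv_le_comm₀ (by norm_num) h0]; exact h2
      have : 2 ≤ 1 / (1 - α) := by rw [le_div_iff₀ h1']; linarith
      linarith
    -- Here p = 2, and the claim reduces to 2x ≤ 2^x for x = 1/(1 − α) ≥ 2.
    have hbern := one_add_mul_self_le_rpow_one_add (s := 1) (by norm_num) hb
    have h3 : 2 ≤ (1 - α) * 2 ^ (1 / (1 - α)) := by
      have e2 : (2 : ℝ) ^ (1 / (1 - α)) = 2 * 2 ^ (1 / (1 - α) - 1) := by
        rw [Real.rpow_sub_one (by norm_num)]; ring
      have e3 : (1 + 1 : ℝ) = 2 := by norm_num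
      rw [e3] at hbern
      rw [e2]
      have h4 : 1 / (1 - α) ≤ 2 ^ (1 / (1 - α) - 1) := by linarith
      have h5 := mul_le_mul_of_nonneg_left h4 h1'.le
      rw [mul_one_div_cancel h1'.ne'] at h5
      linarith
    calc ∑ x ∈ S, d x * (h x ^ (2 : ℝ) - truncBregman 2 t (h x))
        ≤ ∑ x ∈ S, d x * (2 * t * h x) := Finset.sum_le_sum fun x hx =>
          mul_le_mul_of_nonneg_left (rpow_two_sub_truncBregman_le ht (hh x)) (hd x hx)
      _ = 2 * t * ∑ x ∈ S, d x * h x := by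
          rw [Finset.mul_sum]
          exact Finset.sum_congr rfl fun x _ => by ring
      _ ≤ 2 * t * 1 := by gcongr
      _ ≤ ((1 - α) * 2 ^ (1 / (1 - α))) * t := by
          rw [mul_one]; exact mul_le_mul_of_nonneg_right h3 ht.le
      _ = _ := by ring

end Contraction

/-! ### The excess density of the walk on the growing graph. -/

noncomputable section

namespace GrowingGraph

variable {V E : Type*} (G : GrowingGraph V E)

theorem mem_verts {t : ℕ} {x : V} : x ∈ G.verts t ↔ x ∈ G.nonisolated (G.edges t) := by
  simp [verts]

theorem verts_mono {s t : ℕ} (hst : s ≤ t) : G.verts s ⊆ G.verts t := by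
  intro x hx
  rw [mem_verts] at hx ⊢
  obtain ⟨y, hne, e, he, hee⟩ := hx
  exact ⟨y, hne, e, G.edges_mono hst he, hee⟩

theorem mult_symm (t : ℕ) (x y : V) : G.mult t x y = G.mult t y x := by
  simp [mult, Sym2.eq_swap]

theorem mult_mono {s t : ℕ} (hst : s ≤ t) (x y : V) : G.mult s x y ≤ G.mult t x y := by
  refine Set.ncard_le_ncard (fun e he => ⟨G.edges_mono hst he.1, he.2⟩) ?_
  refine (G.locallyFinite x).subset fun e he => ?_
  simp only [Set.mem_ofPred_eq] at he ⊢
  rw [he.2]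
  exact Sym2.mem_mk_left x y

theorem mult_eq_zero {t : ℕ} {x y : V} (hx : x ∈ G.verts t) (hy : y ∉ G.verts t) :
    G.mult t x y = 0 := by
  have : {e | e ∈ G.edges t ∧ G.ends e = s(x, y)} = ∅ := by
    ext e
    simp only [Set.mem_ofPred_eq, Set.mem_empty_iff_false, iff_false, not_and]
    intro he hee
    refine hy ((G.mem_verts).2 ⟨x, fun h => hy (h ▸ hx), e, he, ?_⟩)
    rw [hee, Sym2.eq_swap]
  rw [mult, this, Set.ncard_empty]

theorem deg_nonneg (t : ℕ) (x : V) : 0 ≤ G.deg t x :=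
  Finset.sum_nonneg fun _ _ => Nat.cast_nonneg _

theorem deg_mono {s t : ℕ} (hst : s ≤ t) (x : V) : G.deg s x ≤ G.deg t x := by
  unfold deg
  calc _ ≤ ∑ y ∈ G.verts s, (G.mult t x y : ℝ) :=
        Finset.sum_le_sum fun y _ => Nat.cast_le.2 (G.mult_mono hst x y)
    _ ≤ _ := Finset.sum_le_sum_of_subset_of_nonneg (G.verts_mono hst)
        fun _ _ _ => Nat.cast_nonneg _

theorem vol_mono {s t : ℕ} (hst : s ≤ t) : G.vol s ≤ G.vol t := by
  unfold vol meas
  calc _ ≤ ∑ x ∈ G.verts s, G.deg t x := Finset.sum_le_sum fun x _ => G.deg_mono hst x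
    _ ≤ _ := Finset.sum_le_sum_of_subset_of_nonneg (G.verts_mono hst) fun x _ _ => G.deg_nonneg t x

variable {G} {γ : ℝ}

theorem UniformlyLazy.deg_pos (hG : G.UniformlyLazy γ) (hγ0 : 0 < γ) {t : ℕ} {x : V}
    (hx : x ∈ G.verts t) : 0 < G.deg t x := by
  refine (G.deg_nonneg t x).lt_of_ne' fun h => ?_
  have := hG t x hx
  rw [step, h, div_zero] at this
  linarith

theorem UniformlyLazy.one_le_deg (hG : G.UniformlyLazy γ) (hγ0 : 0 < γ) {t : ℕ} {x : V}
    (hx : x ∈ G.verts t) : 1 ≤ G.deg t x := by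
  have := hG.deg_pos hγ0 hx
  unfold deg at *
  rw [← Nat.cast_sum] at *
  exact_mod_cast this

theorem UniformlyLazy.mul_deg_le (hG : G.UniformlyLazy γ) (hγ0 : 0 < γ) {t : ℕ} {x : V}
    (hx : x ∈ G.verts t) : γ * G.deg t x ≤ G.mult t x x := by
  have := hG t x hx
  rwa [step, le_div_iff₀ (hG.deg_pos hγ0 hx)] at this

theorem UniformlyLazy.vol_pos (hG : G.UniformlyLazy γ) (hγ0 : 0 < γ) {t : ℕ} {x : V}
    (hx : x ∈ G.verts t) : 0 < G.vol t :=
  Finset.sum_pos (fun _ hy => hG.deg_pos hγ0 hy) ⟨x, hx⟩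

variable (G)

theorem step_nonneg (t : ℕ) (x y : V) : 0 ≤ G.step t x y :=
  div_nonneg (Nat.cast_nonneg _) (G.deg_nonneg t x)

theorem trans_nonneg (x₀ : V) (t : ℕ) (y : V) : 0 ≤ G.trans x₀ t y := by
  induction t generalizing y with
  | zero => rw [trans]; split_ifs <;> norm_num
  | succ t ih =>
    rw [trans]
    exact Finset.sum_nonneg fun z _ => mul_nonneg (ih z) (G.step_nonneg t z y)

theorem trans_succ_eq_zero (x₀ : V) {t : ℕ} {y : V} (hy : y ∉ G.verts t) :
    G.trans x₀ (t + 1) y = 0 := by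
  rw [trans]
  refine Finset.sum_eq_zero fun z hz => ?_
  rw [step, G.mult_eq_zero hz hy]
  simp

theorem trans_eq_zero {x₀ : V} (hx₀ : x₀ ∈ G.verts 0) {t : ℕ} {y : V} (hy : y ∉ G.verts t) :
    G.trans x₀ t y = 0 := by
  cases t with
  | zero =>
    rw [trans, if_neg]
    rintro rfl
    exact hy hx₀
  | succ t => exact G.trans_succ_eq_zero x₀ fun h => hy (G.verts_mono t.le_succ h)

theorem sum_trans_le_one (x₀ : V) (t : ℕ) : ∑ y ∈ G.verts t, G.trans x₀ t y ≤ 1 := by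
  classical
  induction t with
  | zero =>
    simp only [trans]
    rw [Finset.sum_ite_eq' (G.verts 0) x₀ fun _ => (1 : ℝ)]
    split_ifs <;> norm_num
  | succ t ih =>
    refine le_trans (le_of_eq ?_) (le_trans ?_ ih) (b := ∑ y ∈ G.verts t, G.trans x₀ (t + 1) y)
    · exact (Finset.sum_subset (G.verts_mono t.le_succ)
        fun y _ hy => G.trans_succ_eq_zero x₀ hy).symm
    · simp only [trans]
      rw [Finset.sum_comm]
      refine Finset.sum_le_sum fun z _ => ?_
      rw [← Finset.mul_sum]
      refine mul_le_of_le_one_right (G.trans_nonneg x₀ t z) ?_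
      simp only [step]
      rw [← Finset.sum_div]
      exact div_self_le_one _

/-- The amount by which the density of the walk with respect to the degrees exceeds `c`. -/
def excess (x₀ : V) (c : ℝ) (t : ℕ) (x : V) : ℝ := max (G.trans x₀ t x / G.deg t x - c) 0

/-- The `p`-th power of the `Lᵖ` norm of the excess. -/
def excessNorm (x₀ : V) (c p : ℝ) (t : ℕ) : ℝ :=
  ∑ x ∈ G.verts t, G.deg t x * G.excess x₀ c t x ^ p

theorem excess_nonneg (x₀ : V) (c : ℝ) (t : ℕ) (x : V) : 0 ≤ G.excess x₀ c t x := le_max_right _ _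

theorem excess_eq_zero {x₀ : V} (hx₀ : x₀ ∈ G.verts 0) {c : ℝ} (hc : 0 ≤ c) {t : ℕ} {x : V}
    (hx : x ∉ G.verts t) : G.excess x₀ c t x = 0 := by
  simp [excess, G.trans_eq_zero hx₀ hx, hc]

variable {G}

theorem UniformlyLazy.deg_mul_excess_le (hG : G.UniformlyLazy γ) (hγ0 : 0 < γ) (x₀ : V) {c : ℝ}
    (hc : 0 ≤ c) {t : ℕ} {x : V} (hx : x ∈ G.verts t) :
    G.deg t x * G.excess x₀ c t x ≤ G.trans x₀ t x := by
  have hd := hG.deg_pos hγ0 hx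
  have : G.excess x₀ c t x ≤ G.trans x₀ t x / G.deg t x :=
    max_le (by linarith) (div_nonneg (G.trans_nonneg _ _ _) hd.le)
  rwa [le_div_iff₀ hd, mul_comm] at this

theorem UniformlyLazy.sum_deg_mul_excess_le_one (hG : G.UniformlyLazy γ) (hγ0 : 0 < γ) (x₀ : V)
    {c : ℝ} (hc : 0 ≤ c) (t : ℕ) {B : Finset V} (hB : B ⊆ G.verts t) :
    ∑ x ∈ B, G.deg t x * G.excess x₀ c t x ≤ 1 :=
  calc _ ≤ ∑ x ∈ B, G.trans x₀ t x :=
        Finset.sum_le_sum fun _ hx => hG.deg_mul_excess_le hγ0 x₀ hc (hB hx)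
    _ ≤ ∑ x ∈ G.verts t, G.trans x₀ t x :=
        Finset.sum_le_sum_of_subset_of_nonneg hB fun _ _ _ => G.trans_nonneg _ _ _
    _ ≤ 1 := G.sum_trans_le_one x₀ t

/-- This is where growth of the graph is used: averaging the constant `c` with time-`t` weights and
dividing by the larger degree at time `t + 1` gives at most `c`. -/
theorem UniformlyLazy.excess_succ_le (hG : G.UniformlyLazy γ) (hγ0 : 0 < γ) (x₀ : V) {c : ℝ}
    (hc : 0 ≤ c) {t : ℕ} {y : V} (hy : y ∈ G.verts t) :
    G.excess x₀ c (t + 1) y ≤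
      (∑ z ∈ G.verts t, (G.mult t y z : ℝ) * G.excess x₀ c t z) / G.deg (t + 1) y := by
  have hd := hG.deg_pos hγ0 (G.verts_mono t.le_succ hy)
  have hdd := G.deg_mono t.le_succ y
  have hT : 0 ≤ ∑ z ∈ G.verts t, (G.mult t y z : ℝ) * G.excess x₀ c t z :=
    Finset.sum_nonneg fun z _ => mul_nonneg (Nat.cast_nonneg _) (G.excess_nonneg _ _ _ _)
  refine max_le ?_ (div_nonneg hT hd.le)
  rw [sub_le_iff_le_add, div_add' _ _ _ hd.ne']
  refine div_le_div_of_nonneg_right ?_ hd.le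
  have h1 : G.trans x₀ (t + 1) y ≤
      ∑ z ∈ G.verts t, (G.mult t y z : ℝ) * (G.excess x₀ c t z + c) := by
    rw [trans]
    refine Finset.sum_le_sum fun z _ => ?_
    have : G.trans x₀ t z / G.deg t z ≤ G.excess x₀ c t z + c := by
      rw [← sub_le_iff_le_add]; exact le_max_left _ _
    rw [step, G.mult_symm t z y]
    calc _ = (G.mult t y z : ℝ) * (G.trans x₀ t z / G.deg t z) := by ring
      _ ≤ _ := mul_le_mul_of_nonneg_left this (Nat.cast_nonneg _)
  simp only [mul_add, Finset.sum_add_distrib, ← Finset.sum_mul] at h1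
  have h2 : (∑ z ∈ G.verts t, (G.mult t y z : ℝ)) * c ≤ c * G.deg (t + 1) y := by
    rw [mul_comm]
    exact mul_le_mul_of_nonneg_left hdd hc
  linarith

theorem UniformlyLazy.excessNorm_succ_le (hG : G.UniformlyLazy γ) (hγ0 : 0 < γ) (x₀ : V)
    {c p : ℝ} (hc : 0 ≤ c) (hp : 1 ≤ p) (t : ℕ) :
    G.excessNorm x₀ c p (t + 1) ≤ ∑ x ∈ G.verts t, G.deg t x *
      ((∑ z ∈ G.verts t, (G.mult t x z : ℝ) * G.excess x₀ c t z) / G.deg t x) ^ p := by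
  rw [excessNorm, ← Finset.sum_subset (G.verts_mono t.le_succ)]
  · refine Finset.sum_le_sum fun x hx => ?_
    have hd := hG.deg_pos hγ0 hx
    have hd' := hG.deg_pos hγ0 (G.verts_mono t.le_succ hx)
    have hdd := G.deg_mono t.le_succ x
    have hle := hG.excess_succ_le hγ0 x₀ hc hx
    set T := ∑ z ∈ G.verts t, (G.mult t x z : ℝ) * G.excess x₀ c t z
    have hT : 0 ≤ T :=
      Finset.sum_nonneg fun z _ => mul_nonneg (Nat.cast_nonneg _) (G.excess_nonneg _ _ _ _)
    -- The exponent 1 − p is nonpositive, so replacing the new degree by the old one only increases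
    -- the term.
    have e : ∀ d : ℝ, 0 < d → d * (T / d) ^ p = T ^ p * d ^ (1 - p) := by
      intro d hd
      rw [Real.div_rpow hT hd.le, Real.rpow_sub hd, Real.rpow_one]; ring
    calc G.deg (t + 1) x * G.excess x₀ c (t + 1) x ^ p
        ≤ G.deg (t + 1) x * (T / G.deg (t + 1) x) ^ p := by
          refine mul_le_mul_of_nonneg_left ?_ hd'.le
          exact Real.rpow_le_rpow (G.excess_nonneg _ _ _ _) hle (by linarith)
      _ = T ^ p * G.deg (t + 1) x ^ (1 - p) := e _ hd'
      _ ≤ T ^ p * G.deg t x ^ (1 - p) := by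
          refine mul_le_mul_of_nonneg_left ?_ (by positivity)
          exact Real.rpow_le_rpow_of_nonpos hd hdd (by linarith)
      _ = _ := (e _ hd).symm
  · intro y _ hy
    have : G.excess x₀ c (t + 1) y = 0 := by
      simp [excess, G.trans_succ_eq_zero x₀ hy, hc]
    rw [this, Real.zero_rpow (by linarith), mul_zero]

theorem UniformlyLazy.excessNorm_le (hG : G.UniformlyLazy γ) (hγ0 : 0 < γ) {x₀ : V}
    (hx₀ : x₀ ∈ G.verts 0) {c p : ℝ} (hc : 0 ≤ c) (hp : 1 ≤ p) (t : ℕ) :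
    G.excessNorm x₀ c p t ≤ G.deg 0 x₀ ^ (1 - p) := by
  induction t with
  | zero =>
    have hd := hG.deg_pos hγ0 hx₀
    rw [excessNorm, Finset.sum_eq_single_of_mem x₀ hx₀]
    · have h1 : G.excess x₀ c 0 x₀ ≤ 1 / G.deg 0 x₀ := by
        refine max_le ?_ (by positivity)
        rw [trans, if_pos rfl]; linarith
      calc _ ≤ G.deg 0 x₀ * (1 / G.deg 0 x₀) ^ p :=
            mul_le_mul_of_nonneg_left (Real.rpow_le_rpow (G.excess_nonneg _ _ _ _) h1
              (by linarith)) hd.le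
        _ = _ := by
            rw [Real.div_rpow zero_le_one hd.le, Real.rpow_sub hd, Real.rpow_one, Real.one_rpow]
            ring
    · intro y _ hy
      have : G.excess x₀ c 0 y = 0 := by
        rw [excess, trans, if_neg hy]; simp [hc]
      rw [this, Real.zero_rpow (by linarith), mul_zero]
  | succ t ih =>
    refine (hG.excessNorm_succ_le hγ0 x₀ hc hp t).trans (le_trans ?_ ih)
    exact jensen_reversible (G.verts t) (fun x y => (G.mult t x y : ℝ))
      (fun x y => by rw [G.mult_symm]) (fun _ _ => Nat.cast_nonneg _)
      (fun x hx => hG.deg_pos hγ0 hx) (convexOn_rpow hp) (G.excess x₀ c t)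
      (G.excess_nonneg x₀ c t)

/-- Sets on which the excess over `2 / v(s)` is positive have at most half the volume. -/
theorem UniformlyLazy.meas_le_half_vol (hG : G.UniformlyLazy γ) (hγ0 : 0 < γ) {x₀ : V}
    (hx₀ : x₀ ∈ G.verts 0) {s u : ℕ} (hsu : s ≤ u) {B : Finset V} (hB : B ⊆ G.verts u)
    (hpos : ∀ x ∈ B, 0 < G.excess x₀ (2 / G.vol s) u x) : G.meas u B ≤ G.vol u / 2 := by
  have hv := hG.vol_pos hγ0 (G.verts_mono s.zero_le hx₀)
  have h1 : G.meas u B * (2 / G.vol s) ≤ 1 := by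
    rw [meas, Finset.sum_mul]
    calc _ ≤ ∑ x ∈ B, G.trans x₀ u x := by
          refine Finset.sum_le_sum fun x hx => ?_
          have hd := hG.deg_pos hγ0 (hB hx)
          have := hpos x hx
          rw [excess, lt_max_iff, or_iff_left (lt_irrefl _), sub_pos, lt_div_iff₀ hd] at this
          linarith
      _ ≤ ∑ x ∈ G.verts u, G.trans x₀ u x :=
          Finset.sum_le_sum_of_subset_of_nonneg hB fun _ _ _ => G.trans_nonneg _ _ _
      _ ≤ 1 := G.sum_trans_le_one x₀ u
  have h2 : G.meas u B ≤ G.vol s / 2 := by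
    rw [← mul_div_assoc, div_le_one hv] at h1
    linarith
  linarith [G.vol_mono hsu]

theorem UniformlyLazy.meas_le_inv (hG : G.UniformlyLazy γ) (hγ0 : 0 < γ) (x₀ : V) {c t : ℝ}
    (hc : 0 ≤ c) (ht : 0 < t) {u : ℕ} {B : Finset V} (hB : B ⊆ G.verts u)
    (hlt : ∀ x ∈ B, t < G.excess x₀ c u x) : G.meas u B ≤ t⁻¹ := by
  rw [← one_div, le_div_iff₀ ht, meas, Finset.sum_mul]
  refine le_trans (Finset.sum_le_sum fun x hx => ?_) (hG.sum_deg_mul_excess_le_one hγ0 x₀ hc u hB)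
  exact mul_le_mul_of_nonneg_left (hlt x hx).le (G.deg_nonneg u x)

variable (G)

theorem iso_anti (u : ℕ) {r r' : ℝ} (h : r ≤ r') : G.iso u r' ≤ G.iso u r := by
  unfold iso
  refine le_iInf₂ fun A hA => le_iInf₂ fun hne hle => ?_
  exact iInf₂_le_of_le A hA (iInf₂_le_of_le hne (hle.trans (min_le_min_left _ h)) le_rfl)

open scoped Classical in
theorem iso_le {u : ℕ} {r : ℝ} {A : Finset V} (hA : A ⊆ G.verts u) (hne : A.Nonempty)
    (h1 : G.meas u A ≤ G.vol u / 2) (h2 : G.meas u A ≤ r) :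
    G.iso u r ≤ ENNReal.ofReal (G.flow u A (G.verts u \ A) / G.meas u A) := by
  unfold iso
  exact iInf₂_le_of_le A hA (iInf₂_le_of_le hne (le_min h1 h2) le_rfl)

variable {G}

open scoped Classical in
theorem UniformlyLazy.iso_mul_meas_le (hG : G.UniformlyLazy γ) (hγ0 : 0 < γ) {u : ℕ} {r : ℝ}
    {A : Finset V} (hA : A ⊆ G.verts u) (hne : A.Nonempty)
    (h1 : G.meas u A ≤ G.vol u / 2) (h2 : G.meas u A ≤ r) :
    (G.iso u r).toReal * G.meas u A ≤ G.flow u A (G.verts u \ A) := by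
  have hm : 0 < G.meas u A := Finset.sum_pos (fun _ hy => hG.deg_pos hγ0 (hA hy)) hne
  have hf : 0 ≤ G.flow u A (G.verts u \ A) :=
    Finset.sum_nonneg fun _ _ => Finset.sum_nonneg fun _ _ => Nat.cast_nonneg _
  rw [← le_div_iff₀ hm]
  exact ENNReal.toReal_le_of_le_ofReal (by positivity) (G.iso_le hA hne h1 h2)

/-- Test the infimum with the singleton `{x}`, whose self-loops carry at least the fraction γ of its
degree. The bound later keeps the contraction factor nonnegative. -/
theorem UniformlyLazy.iso_toReal_le (hG : G.UniformlyLazy γ) (hγ0 : 0 < γ) {u : ℕ} {r : ℝ}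
    {x : V} (hx : x ∈ G.verts u) (h1 : G.deg u x ≤ G.vol u / 2) (h2 : G.deg u x ≤ r) :
    (G.iso u r).toReal ≤ 1 - γ := by
  classical
  have hd := hG.deg_pos hγ0 hx
  have hm : G.meas u {x} = G.deg u x := by simp [meas]
  have := hG.iso_mul_meas_le hγ0 (A := {x}) (by simpa using hx) ⟨x, by simp⟩ (by rwa [hm])
    (by rwa [hm]) (r := r)
  have hf : G.flow u {x} (G.verts u \ {x}) ≤ (1 - γ) * G.deg u x := by
    have hl := hG.mul_deg_le hγ0 hx
    have : G.deg u x = G.flow u {x} (G.verts u \ {x}) + G.mult u x x := by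
      rw [flow, Finset.sum_singleton, deg, ← Finset.sum_sdiff (Finset.singleton_subset_iff.2 hx),
        Finset.sum_singleton]
    linarith
  rw [hm] at this
  exact le_of_mul_le_mul_right (this.trans hf) hd

end GrowingGraph

end

/-! ### The recursion for L and the pointwise bound. -/

noncomputable section

namespace GrowingGraph

variable {V E : Type*} (G : GrowingGraph V E)

theorem nextL_nonneg (c α : ℝ) (u : ℕ) (L : ℝ) : 0 ≤ G.nextL c α u L :=
  Real.sSup_nonneg fun _ hℓ => hℓ.1.le

/-- For z ≤ l/2 the radius z^{1/(α−1)} is at least its value at l/2, so φ_u is at most its value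
there. The integral from ℓ/2 to l/2 is then at least that of 1/(cφ²z), namely log(l/ℓ)/(cφ²). -/
theorem le_nextL {c α : ℝ} (hc : 0 < c) (hα : α < 1) (u : ℕ) {l L : ℝ} (hl : 0 < l) (hlL : l ≤ L)
    (hiso : G.iso u ((l / 2) ^ (1 / (α - 1))) ≠ ⊤) :
    l * Real.exp (-(c * (G.iso u ((l / 2) ^ (1 / (α - 1)))).toReal ^ 2)) ≤ G.nextL c α u L := by
  set Φ := G.iso u ((l / 2) ^ (1 / (α - 1))) with hΦ
  set φ := Φ.toReal with hφ
  refine le_of_forall_lt fun ℓ' hℓ' => ?_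
  obtain ⟨ℓ, hℓ1, hℓ2⟩ := exists_between (max_lt hℓ' (by positivity : 0 < l * Real.exp (-(c * φ ^ 2))))
  have hℓ0 : 0 < ℓ := (le_max_right _ _).trans_lt hℓ1
  refine ((le_max_left _ _).trans_lt hℓ1).trans_le ?_
  have hexp1 : Real.exp (-(c * φ ^ 2)) ≤ 1 := Real.exp_le_one_iff.2 (by
    have := mul_nonneg hc.le (sq_nonneg φ)
    linarith)
  have hℓl : ℓ < l := hℓ2.trans_le (mul_le_of_le_one_right hl.le hexp1)
  refine le_csSup ⟨L, fun _ h => h.2.1⟩ ⟨hℓ0, hℓl.le.trans hlL, ?_⟩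
  -- The comparison integrand uses `K` in place of cφ², which may be 0. Since ℓ < l, `K` is
  -- positive, and the comparison integral is exactly 1.
  set K := Real.log (l / ℓ) with hK
  have hKφ : c * φ ^ 2 ≤ K := by
    rw [hK, Real.le_log_iff_exp_le (by positivity), le_div_iff₀ hℓ0]
    have h := mul_le_mul_of_nonneg_left hℓ2.le (Real.exp_pos (c * φ ^ 2)).le
    rw [mul_left_comm, ← Real.exp_add, add_neg_cancel, Real.exp_zero, mul_one] at h
    exact h
  have hK0 : 0 < K := Real.log_pos (by rwa [lt_div_iff₀ hℓ0, one_mul])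
  have hint : ∫ z in Set.Ioc (ℓ / 2) (l / 2), K⁻¹ * z⁻¹ = 1 := by
    rw [← intervalIntegral.integral_of_le (by linarith), intervalIntegral.integral_const_mul,
      integral_inv_of_pos (by linarith) (by linarith)]
    rw [show l / 2 / (ℓ / 2) = l / ℓ by field_simp, ← hK, inv_mul_cancel₀ hK0.ne']
  have hintegrable : MeasureTheory.IntegrableOn (fun z : ℝ => K⁻¹ * z⁻¹)
      (Set.Ioc (ℓ / 2) (l / 2)) := by
    refine (intervalIntegrable_iff_integrableOn_Ioc_of_le (by linarith)).1 ?_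
    refine (intervalIntegral.intervalIntegrable_inv (fun x hx => ?_) continuousOn_id).const_mul _
    rw [Set.uIcc_of_le (by linarith)] at hx
    exact (lt_of_lt_of_le (by linarith) hx.1).ne'
  calc (1 : ℝ≥0∞) = ENNReal.ofReal (∫ z in Set.Ioc (ℓ / 2) (l / 2), K⁻¹ * z⁻¹) := by
        rw [hint, ENNReal.ofReal_one]
    _ = ∫⁻ z in Set.Ioc (ℓ / 2) (l / 2), ENNReal.ofReal (K⁻¹ * z⁻¹) := by
        refine MeasureTheory.ofReal_integral_eq_lintegral_ofReal hintegrable ?_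
        refine (MeasureTheory.ae_restrict_mem measurableSet_Ioc).mono fun z hz => ?_
        have : 0 < z := lt_trans (by linarith) hz.1
        simp only [Pi.zero_apply]
        positivity
    _ ≤ ∫⁻ z in Set.Ioc (ℓ / 2) (l / 2),
        (ENNReal.ofReal c * ENNReal.ofReal z * G.iso u (z ^ (1 / (α - 1))) ^ 2)⁻¹ := by
        refine MeasureTheory.setLIntegral_mono' measurableSet_Ioc fun z hz => ?_
        have hz0 : 0 < z := lt_trans (by linarith) hz.1
        rw [← mul_inv, ENNReal.ofReal_inv_of_pos (by positivity)]
        refine ENNReal.inv_le_inv' ?_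
        have h1 : G.iso u (z ^ (1 / (α - 1))) ≤ Φ :=
          G.iso_anti u (Real.rpow_le_rpow_of_nonpos hz0 hz.2
            (div_nonpos_of_nonneg_of_nonpos zero_le_one (by linarith)))
        calc ENNReal.ofReal c * ENNReal.ofReal z * G.iso u (z ^ (1 / (α - 1))) ^ 2
            ≤ ENNReal.ofReal c * ENNReal.ofReal z * Φ ^ 2 := by gcongr
          _ = ENNReal.ofReal (c * z * φ ^ 2) := by
              rw [ENNReal.ofReal_mul (by positivity), ENNReal.ofReal_mul hc.le,
                ENNReal.ofReal_pow ENNReal.toReal_nonneg, ENNReal.ofReal_toReal hiso]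
          _ ≤ ENNReal.ofReal (K * z) := by
              refine ENNReal.ofReal_le_ofReal ?_
              have := mul_le_mul_of_nonneg_right hKφ hz0.le
              linarith
    _ ≤ _ := MeasureTheory.lintegral_mono_set (Set.Ioc_subset_Ioc_right (by linarith))

variable {G} {γ : ℝ}

theorem UniformlyLazy.excessNorm_succ_le_nextL (hG : G.UniformlyLazy γ) (hγ0 : 0 < γ)
    (hγ : γ ≤ 1 / 2) {α : ℝ} (h0 : 0 < α) (h1 : α < 1) {x₀ : V} (hx₀ : x₀ ∈ G.verts 0)
    {s u : ℕ} (hsu : s ≤ u) {L : ℝ} (hL0 : 0 ≤ L)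
    (hL : G.excessNorm x₀ (2 / G.vol s) (max 2 α⁻¹) u ≤ L ^ ((max 2 α⁻¹ - 1) / (1 - α))) :
    G.excessNorm x₀ (2 / G.vol s) (max 2 α⁻¹) (u + 1) ≤
      G.nextL (2 * α * (1 - α) * γ ^ 2 / (1 - γ) ^ 2) α u L ^ ((max 2 α⁻¹ - 1) / (1 - α)) := by
  classical
  have hv := hG.vol_pos hγ0 (G.verts_mono s.zero_le hx₀)
  have hc : 0 ≤ 2 / G.vol s := by positivity
  have hnext0 := G.nextL_nonneg (2 * α * (1 - α) * γ ^ 2 / (1 - γ) ^ 2) α u L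
  have hloss := fun t : ℝ => truncation_loss_le (t := t) (G.verts u) (G.deg u) (G.excess x₀ (2 / G.vol s) u)
    (fun x _ => G.deg_nonneg u x) (G.excess_nonneg x₀ _ u) h0 h1
  have hp : 2 ≤ max 2 α⁻¹ := le_max_left _ _
  have hpα : 1 ≤ max 2 α⁻¹ * α := by
    have := mul_le_mul_of_nonneg_right (le_max_right 2 α⁻¹) h0.le
    rwa [inv_mul_cancel₀ h0.ne'] at this
  have hα1 : 0 < 1 - α := by linarith
  have hγ1 : 0 < 1 - γ := by linarith
  set p := max 2 α⁻¹
  set c := 2 / G.vol s with hcdef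
  set κ := (p - 1) / (1 - α) with hκ
  have hκ0 : 0 < κ := div_pos (by linarith) hα1
  set h := G.excess x₀ c u with hh
  have hhn : ∀ x, 0 ≤ h x := G.excess_nonneg x₀ c u
  have hsucc := hG.excessNorm_succ_le hγ0 x₀ hc (by linarith : 1 ≤ p) u
  -- With no excess there may be no admissible set and φ_u may be infinite; then only `0 ≤ nextL` is
  -- needed.
  by_cases hzero : ∀ x ∈ G.verts u, h x = 0
  · refine hsucc.trans (le_trans (le_of_eq ?_) (Real.rpow_nonneg hnext0 κ))
    refine Finset.sum_eq_zero fun x _ => ?_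
    rw [Finset.sum_eq_zero fun z hz => by rw [← hh, hzero z hz, mul_zero], zero_div,
      Real.zero_rpow (by linarith), mul_zero]
  push Not at hzero
  obtain ⟨x₁, hx₁, hx₁0⟩ := hzero
  obtain ⟨x, hx, hmin⟩ := ((G.verts u).filter fun x => 0 < h x).exists_min_image (G.deg u)
    ⟨x₁, Finset.mem_filter.2 ⟨hx₁, (hhn x₁).lt_of_ne' hx₁0⟩⟩
  rw [Finset.mem_filter] at hx
  obtain ⟨hxV, hxpos⟩ := hx
  have hd := hG.deg_pos hγ0 hxV
  have hNdef : G.excessNorm x₀ c p u = ∑ x ∈ G.verts u, G.deg u x * h x ^ p := rfl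
  have hNpos : 0 < G.excessNorm x₀ c p u :=
    Finset.sum_pos' (fun y _ => mul_nonneg (G.deg_nonneg u y) (Real.rpow_nonneg (hhn y) p))
      ⟨x, hxV, mul_pos hd (Real.rpow_pos_of_pos hxpos p)⟩
  have hLpos : 0 < L := by
    refine hL0.lt_of_ne fun hL0 => ?_
    rw [← hL0, Real.zero_rpow hκ0.ne'] at hL
    linarith
  -- Here `x` has least degree where the excess is positive. Capping `l` makes `{x}` admissible at
  -- radius `r`, so φ_u(r) is finite and at most 1 − γ. Nothing is lost: h ≤ 1/deg(x) everywhere and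
  -- the mass is at most 1, so the norm is still at most l^κ.
  set l := min L (2 * G.deg u x ^ (α - 1)) with hl
  have hl0 : 0 < l := lt_min hLpos (by positivity)
  set r := (l / 2) ^ (1 / (α - 1)) with hr
  -- This level makes 1/t the radius `r`, matching the measure bound for {h > t}, and makes 2^κ
  -- t^{p−1} = l^κ, the normalization in `truncation_loss_le`.
  set t := (l / 2) ^ (1 / (1 - α)) with ht
  have ht0 : 0 < t := by positivity
  have hrt : t⁻¹ = r := by
    rw [ht, hr, ← Real.rpow_neg (by positivity)]
    congr 1
    rw [← neg_sub, div_neg, neg_neg]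
  have hmeasx : G.meas u {x} = G.deg u x := by simp [meas]
  have hxhalf : G.deg u x ≤ G.vol u / 2 := by
    rw [← hmeasx]
    exact hG.meas_le_half_vol hγ0 hx₀ hsu (by simpa using hxV) (by simpa using hxpos)
  have hxr : G.deg u x ≤ r := by
    have : (l / 2) ≤ G.deg u x ^ (α - 1) := by
      have := min_le_right L (2 * G.deg u x ^ (α - 1))
      linarith
    have h2 := Real.rpow_le_rpow_of_nonpos (by positivity) this (z := 1 / (α - 1))
      (div_nonpos_of_nonneg_of_nonpos zero_le_one (by linarith))
    rwa [← Real.rpow_mul hd.le, mul_one_div_cancel (by linarith), Real.rpow_one] at h2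
  have hiso : G.iso u r ≠ ⊤ := by
    refine ne_top_of_le_ne_top ENNReal.ofReal_ne_top (G.iso_le (A := {x}) (by simpa using hxV)
      ⟨x, by simp⟩ (by rwa [hmeasx]) (by rwa [hmeasx]))
  set φ := (G.iso u r).toReal with hφ
  have hφ0 : 0 ≤ φ := ENNReal.toReal_nonneg
  have hφ1 : φ ≤ 1 - γ := hG.iso_toReal_le hγ0 hxV hxhalf hxr
  have hmass := hG.sum_deg_mul_excess_le_one hγ0 x₀ hc u (subset_refl (G.verts u))
  have hNl : G.excessNorm x₀ c p u ≤ l ^ κ := by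
    rcases min_choice L (2 * G.deg u x ^ (α - 1)) with hcase | hcase
    · rw [hl, hcase]; exact hL
    · rw [hl, hcase, Real.mul_rpow (by norm_num) (by positivity), ← Real.rpow_mul hd.le,
        show (α - 1) * κ = -(p - 1) by rw [hκ]; field_simp; ring]
      have hsup : ∀ y ∈ G.verts u, h y ^ (p - 1) ≤ G.deg u x ^ (-(p - 1)) := by
        intro y hy
        rcases (hhn y).eq_or_lt with h00 | hypos
        · rw [← h00, Real.zero_rpow (by linarith)]; positivity
        · have hdy := hG.deg_pos hγ0 hy
          have h2 : h y ≤ (G.deg u x)⁻¹ := by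
            have h3 := hmin y (Finset.mem_filter.2 ⟨hy, hypos⟩)
            have h4 := hG.sum_deg_mul_excess_le_one hγ0 x₀ hc u (B := {y}) (by simpa using hy)
            rw [Finset.sum_singleton] at h4
            rw [← one_div, le_div_iff₀ hd]
            calc h y * G.deg u x ≤ h y * G.deg u y := mul_le_mul_of_nonneg_left h3 (hhn y)
              _ ≤ 1 := by rw [mul_comm]; exact h4
          calc h y ^ (p - 1) ≤ (G.deg u x)⁻¹ ^ (p - 1) :=
                Real.rpow_le_rpow (hhn y) h2 (by linarith)
            _ = _ := by rw [Real.inv_rpow hd.le, Real.rpow_neg hd.le]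
      calc G.excessNorm x₀ c p u
          ≤ ∑ y ∈ G.verts u, G.deg u y * h y * G.deg u x ^ (-(p - 1)) := by
            refine Finset.sum_le_sum fun y hy => ?_
            rw [mul_assoc]
            refine mul_le_mul_of_nonneg_left ?_ (G.deg_nonneg u y)
            have : h y ^ p = h y * h y ^ (p - 1) := by
              rcases (hhn y).eq_or_lt with h00 | hypos
              · rw [← h00, Real.zero_rpow (by linarith), zero_mul]
              · rw [Real.rpow_sub_one hypos.ne']; field_simp
            change h y ^ p ≤ _
            rw [this]
            exact mul_le_mul_of_nonneg_left (hsup y hy) (hhn y)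
        _ = (∑ y ∈ G.verts u, G.deg u y * h y) * G.deg u x ^ (-(p - 1)) := by
            rw [Finset.sum_mul]
        _ ≤ 2 ^ κ * G.deg u x ^ (-(p - 1)) := by
            refine mul_le_mul_of_nonneg_right (hmass.trans ?_) (by positivity)
            exact Real.one_le_rpow (by norm_num) hκ0.le
  have hlt : 2 ^ κ * t ^ (p - 1) = l ^ κ := by
    rw [ht, ← Real.rpow_mul (by positivity), show 1 / (1 - α) * (p - 1) = κ by rw [hκ]; ring,
      ← Real.mul_rpow (by norm_num) (by positivity)]
    congr 1
    ring
  have hloss' := hloss t ht0 hmass (by rw [hlt]; exact hNl)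
  rw [hlt] at hloss'
  have hcontr := rpow_contraction (G.verts u) (fun x y => (G.mult u x y : ℝ))
    (fun x y => by rw [G.mult_symm]) (fun _ _ => Nat.cast_nonneg _)
    (fun x hx => hG.deg_pos hγ0 hx) γ hγ0 hγ (fun x hx => hG.mul_deg_le hγ0 hx) φ hφ0 hp ht0 h hhn
    (fun B hB hlt hne => by
      refine hG.iso_mul_meas_le hγ0 hB hne
        (hG.meas_le_half_vol hγ0 hx₀ hsu hB fun x hx => ht0.trans (hlt x hx)) ?_
      rw [← hrt]
      exact hG.meas_le_inv hγ0 x₀ hc ht0 hB hlt)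
  have hnext := G.le_nextL (c := 2 * α * (1 - α) * γ ^ 2 / (1 - γ) ^ 2) (by positivity) h1 u hl0
    (min_le_left L _) hiso
  change _ ≤ (∑ x ∈ G.verts u, G.deg u x * h x ^ p) - 2 * (γ ^ 2 / (1 - γ) ^ 2) * φ ^ 2 *
        ∑ x ∈ G.verts u, G.deg u x * truncBregman p t (h x) at hcontr
  have hN' := hsucc.trans hcontr
  rw [← hNdef] at hN'
  simp only [mul_sub, Finset.sum_sub_distrib] at hloss'
  rw [← hNdef] at hloss'
  set N := G.excessNorm x₀ c p u
  set T := ∑ x ∈ G.verts u, G.deg u x * truncBregman p t (h x)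
  set q := γ ^ 2 / (1 - γ) ^ 2 * φ ^ 2 with hq
  have hq0 : 0 ≤ q := by positivity
  have hq1 : 2 * q ≤ 1 := by
    have h2 : φ ^ 2 ≤ (1 - γ) ^ 2 := pow_le_pow_left₀ hφ0 hφ1 2
    have h3 : q ≤ γ ^ 2 := by
      calc q ≤ γ ^ 2 / (1 - γ) ^ 2 * (1 - γ) ^ 2 := by rw [hq]; gcongr
        _ = γ ^ 2 := by field_simp
    nlinarith
  have hlκ : 0 < l ^ κ := by positivity
  -- Combine N′ ≤ N − 2qT with T ≥ N − (1 − (p − 1)α)l^κ and N ≤ l^κ; the last is multiplied by 1 −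
  -- 2q, hence the need for 2q ≤ 1.
  have hlin : G.excessNorm x₀ c p (u + 1) ≤ l ^ κ * (1 - 2 * q * ((p - 1) * α)) := by
    have h2 : N - (1 - (p - 1) * α) * l ^ κ ≤ T := by linarith
    have h3 := mul_le_mul_of_nonneg_left h2 (by linarith : 0 ≤ 2 * q)
    have h4 := mul_le_mul_of_nonneg_right hNl (by linarith : 0 ≤ 1 - 2 * q)
    have h5 : 2 * (γ ^ 2 / (1 - γ) ^ 2) * φ ^ 2 * T = 2 * q * T := by rw [hq]; ring
    rw [h5] at hN'
    linarith
  calc G.excessNorm x₀ c p (u + 1) ≤ l ^ κ * (1 - 2 * q * ((p - 1) * α)) := hlin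
    _ ≤ l ^ κ * Real.exp (-(2 * q * ((p - 1) * α))) :=
        mul_le_mul_of_nonneg_left (Real.one_sub_le_exp_neg _) hlκ.le
    _ = (l * Real.exp (-(2 * α * (1 - α) * γ ^ 2 / (1 - γ) ^ 2 * φ ^ 2))) ^ κ := by
        rw [Real.mul_rpow hl0.le (Real.exp_pos _).le, ← Real.exp_mul]
        congr 2
        rw [hκ, hq]
        field_simp
    _ ≤ _ := Real.rpow_le_rpow (by positivity) hnext hκ0.le

theorem iterL_nonneg (c α : ℝ) (x₀ : V) (s u : ℕ) : 0 ≤ G.iterL c α x₀ s u := by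
  cases u with
  | zero => exact Real.rpow_nonneg (G.deg_nonneg 0 x₀) _
  | succ u =>
    rw [iterL]
    split_ifs
    · exact G.nextL_nonneg _ _ _ _
    · exact Real.rpow_nonneg (G.deg_nonneg 0 x₀) _

theorem iterL_self (c α : ℝ) (x₀ : V) (s : ℕ) : G.iterL c α x₀ s s = G.deg 0 x₀ ^ (α - 1) := by
  cases s with
  | zero => rfl
  | succ s => rw [iterL, if_neg (by omega)]

theorem UniformlyLazy.excessNorm_le_iterL (hG : G.UniformlyLazy γ) (hγ0 : 0 < γ)
    (hγ : γ ≤ 1 / 2) {α : ℝ} (h0 : 0 < α) (h1 : α < 1) {x₀ : V} (hx₀ : x₀ ∈ G.verts 0)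
    {s u : ℕ} (hsu : s ≤ u) :
    G.excessNorm x₀ (2 / G.vol s) (max 2 α⁻¹) u ≤
      G.iterL (2 * α * (1 - α) * γ ^ 2 / (1 - γ) ^ 2) α x₀ s u ^
        ((max 2 α⁻¹ - 1) / (1 - α)) := by
  have hv := hG.vol_pos hγ0 (G.verts_mono s.zero_le hx₀)
  induction u, hsu using Nat.le_induction with
  | base =>
    have hp : 2 ≤ max 2 α⁻¹ := le_max_left _ _
    have hα1 : 1 - α ≠ 0 := by linarith
    rw [iterL_self, ← Real.rpow_mul (G.deg_nonneg 0 x₀)]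
    refine (hG.excessNorm_le hγ0 hx₀ (by positivity) (by linarith) s).trans (le_of_eq ?_)
    congr 1
    field_simp
    ring
  | succ u hsu ih =>
    rw [iterL, if_pos hsu]
    exact hG.excessNorm_succ_le_nextL hγ0 hγ h0 h1 hx₀ hsu (iterL_nonneg _ _ _ _ _) ih

theorem UniformlyLazy.trans_le_add (hG : G.UniformlyLazy γ) (hγ0 : 0 < γ) (x₀ : V) (c : ℝ) {t : ℕ}
    {y : V} (hy : y ∈ G.verts t) :
    G.trans x₀ t y ≤ c * G.deg t y + G.deg t y * G.excess x₀ c t y := by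
  have hd := hG.deg_pos hγ0 hy
  have : G.trans x₀ t y / G.deg t y - c ≤ G.excess x₀ c t y := le_max_left _ _
  rw [sub_le_iff_le_add, div_le_iff₀ hd] at this
  linarith

/-- Interpolation between the `Lᵖ` bound and the total mass. -/
theorem UniformlyLazy.deg_mul_excess_le_rpow (hG : G.UniformlyLazy γ) (hγ0 : 0 < γ) (x₀ : V)
    {c : ℝ} (hc : 0 ≤ c) {α p : ℝ} (h1 : α < 1) (hp : 1 < p) (hpα : 1 ≤ p * α) {t : ℕ} {y : V}
    (hy : y ∈ G.verts t) {L : ℝ} (hL0 : 0 ≤ L)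
    (hL : G.excessNorm x₀ c p t ≤ L ^ ((p - 1) / (1 - α))) :
    G.deg t y * G.excess x₀ c t y ≤ G.deg t y ^ (1 - α) * L := by
  have hd := hG.deg_pos hγ0 hy
  have hα1 : 0 < 1 - α := by linarith
  have hmass := hG.sum_deg_mul_excess_le_one hγ0 x₀ hc t (B := {y}) (by simpa using hy)
  rw [Finset.sum_singleton] at hmass
  have hle : G.deg t y * G.excess x₀ c t y ^ p ≤ L ^ ((p - 1) / (1 - α)) :=
    (Finset.single_le_sum (f := fun y => G.deg t y * G.excess x₀ c t y ^ p)
      (fun z _ => mul_nonneg (G.deg_nonneg t z) (Real.rpow_nonneg (G.excess_nonneg _ _ _ _) p))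
      hy).trans hL
  have hh := G.excess_nonneg x₀ c t y
  set h := G.excess x₀ c t y
  set d := G.deg t y
  set κ := (p - 1) / (1 - α) with hκ
  have hκ0 : 0 < κ := div_pos (by linarith) hα1
  rcases hh.eq_or_lt with h00 | hpos
  · rw [← h00, mul_zero]; positivity
  have hκp : p ≤ κ := by
    rw [hκ, le_div_iff₀ hα1]
    linarith
  have hαh : d ^ α * h ≤ L := by
    rw [← Real.rpow_le_rpow_iff (by positivity) hL0 hκ0]
    refine le_trans ?_ hle
    -- The condition pα ≥ 1 gives p ≤ κ. As d h ≤ 1, the last factor is at least 1 and can be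
    -- dropped.
    have e : d * h ^ p = (d ^ α * h) ^ κ * (d * h) ^ (p - κ) := by
      rw [Real.mul_rpow (by positivity) hh, Real.mul_rpow hd.le hh, ← Real.rpow_mul hd.le]
      calc d * h ^ p = d ^ (α * κ + (p - κ)) * h ^ (κ + (p - κ)) := by
            rw [show α * κ + (p - κ) = 1 by rw [hκ]; field_simp; ring, Real.rpow_one]
            congr 2
            ring
        _ = _ := by rw [Real.rpow_add hd, Real.rpow_add hpos]; ring
    rw [e]
    exact le_mul_of_one_le_right (by positivity)
      (Real.one_le_rpow_of_pos_of_le_one_of_nonpos (by positivity) hmass (by linarith))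
  calc d * h = d ^ (1 - α) * (d ^ α * h) := by
        rw [← mul_assoc, ← Real.rpow_add hd, sub_add_cancel, Real.rpow_one]
    _ ≤ _ := mul_le_mul_of_nonneg_left hαh (by positivity)

/-! ### L² decay through the Cheeger constants. -/

/-- The `L²` norm of the excess contracts at a rate given by the Cheeger constant. -/
theorem UniformlyLazy.excessNorm_two_succ_le (hG : G.UniformlyLazy γ) (hγ0 : 0 < γ)
    (hγ : γ ≤ 1 / 2) {x₀ : V} (hx₀ : x₀ ∈ G.verts 0) {s u : ℕ} (hsu : s ≤ u) :
    G.excessNorm x₀ (2 / G.vol s) 2 (u + 1) ≤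
      Real.exp (-(2 * (γ ^ 2 / (1 - γ) ^ 2) * G.cheeger u ^ 2)) *
        G.excessNorm x₀ (2 / G.vol s) 2 u := by
  classical
  have hv := hG.vol_pos hγ0 (G.verts_mono s.zero_le hx₀)
  have hc : 0 ≤ 2 / G.vol s := by positivity
  have hsucc := hG.excessNorm_succ_le hγ0 x₀ hc one_le_two u
  set c := 2 / G.vol s with hcdef
  set h := G.excess x₀ c u with hh
  have hcontr := lazy_contraction (G.verts u) ((G.verts u).filter fun x => 0 < h x)
    (Finset.filter_subset _ _) (fun x y => (G.mult u x y : ℝ))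
    (fun x y => by rw [G.mult_symm]) (fun _ _ => Nat.cast_nonneg _)
    (fun x hx => hG.deg_pos hγ0 hx) γ hγ0 hγ (fun x hx => hG.mul_deg_le hγ0 hx) (G.cheeger u)
    ENNReal.toReal_nonneg
    (fun B hB hne => by
      have hBV := hB.trans (Finset.filter_subset _ _)
      have hhalf := hG.meas_le_half_vol hγ0 hx₀ hsu hBV
        fun x hx => (Finset.mem_filter.1 (hB hx)).2
      exact hG.iso_mul_meas_le hγ0 hBV hne hhalf hhalf) h
    (fun x hx => by
      by_cases hxV : x ∈ G.verts u
      · refine le_antisymm ?_ (G.excess_nonneg x₀ c u x)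
        by_contra hcon
        exact hx (Finset.mem_filter.2 ⟨hxV, not_le.1 hcon⟩)
      · exact G.excess_eq_zero hx₀ hc hxV)
  have e1 : G.excessNorm x₀ c 2 u = ∑ x ∈ G.verts u, G.deg u x * h x ^ 2 := by
    simp only [excessNorm, Real.rpow_two, hh]
  have e2 : ∑ x ∈ G.verts u, G.deg u x *
      ((∑ z ∈ G.verts u, (G.mult u x z : ℝ) * h z) / G.deg u x) ^ (2 : ℝ) =
      ∑ x ∈ G.verts u, (∑ z ∈ G.verts u, (G.mult u x z : ℝ) * h z) ^ 2 / G.deg u x := by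
    refine Finset.sum_congr rfl fun x hx => ?_
    have := (hG.deg_pos hγ0 hx).ne'
    rw [Real.rpow_two]
    field_simp
  rw [e2] at hsucc
  change _ ≤ ∑ x ∈ G.verts u, G.deg u x * h x ^ 2 -
    ∑ x ∈ G.verts u, (∑ z ∈ G.verts u, (G.mult u x z : ℝ) * h z) ^ 2 / G.deg u x at hcontr
  change _ * ∑ x ∈ G.verts u, G.deg u x * h x ^ 2 ≤ _ at hcontr
  rw [← e1] at hcontr
  have hN0 : 0 ≤ G.excessNorm x₀ c 2 u := by
    rw [e1]
    exact Finset.sum_nonneg fun x _ => mul_nonneg (G.deg_nonneg u x) (sq_nonneg _)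
  have h3 := mul_le_mul_of_nonneg_right
    (Real.one_sub_le_exp_neg (2 * (γ ^ 2 / (1 - γ) ^ 2) * G.cheeger u ^ 2)) hN0
  linarith

theorem UniformlyLazy.excessNorm_two_le (hG : G.UniformlyLazy γ) (hγ0 : 0 < γ)
    (hγ : γ ≤ 1 / 2) {x₀ : V} (hx₀ : x₀ ∈ G.verts 0) {s t : ℕ} (hst : s ≤ t) :
    G.excessNorm x₀ (2 / G.vol s) 2 t ≤
      Real.exp (-(2 * (γ ^ 2 / (1 - γ) ^ 2) * ∑ u ∈ Finset.Ico s t, G.cheeger u ^ 2)) := by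
  have hv := hG.vol_pos hγ0 (G.verts_mono s.zero_le hx₀)
  induction t, hst using Nat.le_induction with
  | base =>
    refine (hG.excessNorm_le hγ0 hx₀ (by positivity) one_le_two s).trans ?_
    simpa using Real.rpow_le_one_of_one_le_of_nonpos (hG.one_le_deg hγ0 hx₀)
      (by norm_num : (1 : ℝ) - 2 ≤ 0)
  | succ t hst ih =>
    refine (hG.excessNorm_two_succ_le hγ0 hγ hx₀ hst).trans
      ((mul_le_mul_of_nonneg_left ih (Real.exp_pos _).le).trans (le_of_eq ?_))
    rw [← Real.exp_add, Finset.sum_Ico_succ_top hst]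
    congr 1
    ring

theorem UniformlyLazy.deg_mul_excess_le_exp (hG : G.UniformlyLazy γ) (hγ0 : 0 < γ)
    (hγ : γ ≤ 1 / 2) {x₀ : V} (hx₀ : x₀ ∈ G.verts 0) {s t : ℕ} (hst : s ≤ t) {Δ : ℝ} {y : V}
    (hy : y ∈ G.verts t) (hΔ : G.deg t y ≤ Δ) :
    G.deg t y * G.excess x₀ (2 / G.vol s) t y ≤
      √Δ * Real.exp (-(γ ^ 2 / (2 * (1 - γ) ^ 2)) * ∑ u ∈ Finset.Ico s t, G.cheeger u ^ 2) := by
  have hd := hG.deg_pos hγ0 hy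
  have hN := hG.excessNorm_two_le hγ0 hγ hx₀ hst
  have hle : G.deg t y * G.excess x₀ (2 / G.vol s) t y ^ (2 : ℝ) ≤ _ :=
    (Finset.single_le_sum (f := fun y => G.deg t y * G.excess x₀ (2 / G.vol s) t y ^ (2 : ℝ))
      (fun z _ => mul_nonneg (G.deg_nonneg t z) (Real.rpow_nonneg (G.excess_nonneg _ _ _ _) _))
      hy).trans hN
  rw [Real.rpow_two] at hle
  have hΔ0 : 0 < Δ := hd.trans_le hΔ
  refine abs_le_of_sq_le_sq' ?_ (by positivity) |>.2
  rw [mul_pow, mul_pow, Real.sq_sqrt hΔ0.le, ← Real.exp_nat_mul]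
  have hS : 0 ≤ ∑ u ∈ Finset.Ico s t, G.cheeger u ^ 2 := Finset.sum_nonneg fun _ _ => sq_nonneg _
  have hk : 0 ≤ γ ^ 2 / (1 - γ) ^ 2 := by positivity
  calc _ = G.deg t y * (G.deg t y * G.excess x₀ (2 / G.vol s) t y ^ 2) := by ring
    _ ≤ Δ * Real.exp (-(2 * (γ ^ 2 / (1 - γ) ^ 2) * ∑ u ∈ Finset.Ico s t, G.cheeger u ^ 2)) :=
        mul_le_mul hΔ hle (mul_nonneg hd.le (sq_nonneg _)) hΔ0.le
    -- The exponent available is twice the one required after squaring.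
    _ ≤ _ := by
        refine mul_le_mul_of_nonneg_left (Real.exp_le_exp.2 ?_) hΔ0.le
        have e : γ ^ 2 / (2 * (1 - γ) ^ 2) = γ ^ 2 / (1 - γ) ^ 2 / 2 := by
          rw [div_div, mul_comm]
        rw [e]
        push_cast
        have := mul_nonneg hk hS
        linarith

end GrowingGraph

end

theorem theorem1p3 (γ : ℝ) (hγ0 : 0 < γ) (hγ : γ ≤ 1 / 2) :
    (∀ (V E : Type*) (G : GrowingGraph V E), G.UniformlyLazy γ →
      ∀ α : ℝ, 0 < α → α < 1 →
      ∀ x₀ ∈ G.verts 0, ∀ t : ℕ, 2 ≤ t → ∀ y ∈ G.verts t,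
      ∀ s : ℕ, 1 ≤ s → s ≤ t - 1 →
        G.trans x₀ t y ≤
          2 * G.deg t y / G.vol s +
            G.deg t y ^ (1 - α) *
              G.iterL (2 * α * (1 - α) * γ ^ 2 / (1 - γ) ^ 2) α x₀ s t) ∧
    (∀ Δ : ℝ, ∃ C : ℝ,
      ∀ (V E : Type*) (G : GrowingGraph V E), G.UniformlyLazy γ →
      (∀ t, ∀ y ∈ G.verts t, G.deg t y ≤ Δ) →
      ∀ x₀ ∈ G.verts 0, ∀ t : ℕ, 2 ≤ t → ∀ y ∈ G.verts t,
        G.trans x₀ t y ≤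
          C * (1 / G.vol (t / 2) +
            Real.exp (-(γ ^ 2 / (2 * (1 - γ) ^ 2)) *
              ∑ u ∈ Finset.Ico (t / 2) t, G.cheeger u ^ 2))) := by
  refine ⟨fun V E G hG α h0 h1 x₀ hx₀ t _ y hy s _ hst => ?_,
    -- 2Δ comes from the subtracted level 2/v(⌊t/2⌋) times the degree, and √Δ from the L² bound at a
    -- single vertex.
    fun Δ => ⟨2 * Δ + √Δ, fun V E G hG hΔ x₀ hx₀ t _ y hy => ?_⟩⟩
  · have hv := hG.vol_pos hγ0 (G.verts_mono s.zero_le hx₀)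
    have hpα : 1 ≤ max 2 α⁻¹ * α := by
      have := mul_le_mul_of_nonneg_right (le_max_right 2 α⁻¹) h0.le
      rwa [inv_mul_cancel₀ h0.ne'] at this
    have hL := hG.excessNorm_le_iterL hγ0 hγ h0 h1 hx₀ (s := s) (u := t) (by omega)
    have hexc := hG.deg_mul_excess_le_rpow hγ0 x₀ (by positivity) h1
      (lt_of_lt_of_le one_lt_two (le_max_left 2 α⁻¹)) hpα hy
      (GrowingGraph.iterL_nonneg _ _ _ _ _) hL
    have := hG.trans_le_add hγ0 x₀ (2 / G.vol s) hy
    rw [div_mul_eq_mul_div] at this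
    linarith
  · have hv := hG.vol_pos hγ0 (G.verts_mono (t / 2).zero_le hx₀)
    have hexc := hG.deg_mul_excess_le_exp hγ0 hγ hx₀ (Nat.div_le_self t 2) hy (hΔ t y hy)
    have htr := hG.trans_le_add hγ0 x₀ (2 / G.vol (t / 2)) hy
    have hΔ0 : 0 < Δ := (hG.deg_pos hγ0 hy).trans_le (hΔ t y hy)
    have h2 : 2 / G.vol (t / 2) * G.deg t y ≤ 2 * Δ * (1 / G.vol (t / 2)) := by
      calc _ ≤ 2 / G.vol (t / 2) * Δ := mul_le_mul_of_nonneg_left (hΔ t y hy) (by positivity)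
        _ = _ := by ring
    have h3 : 0 ≤ √Δ * (1 / G.vol (t / 2)) := by positivity
    have h4 : 0 ≤ 2 * Δ * Real.exp (-(γ ^ 2 / (2 * (1 - γ) ^ 2)) *
        ∑ u ∈ Finset.Ico (t / 2) t, G.cheeger u ^ 2) := by positivity
    linarith
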